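/- Let $V$ be a locally presentable category. Write $\mathcal{G}V$ for the category of $V$-graphs: a $V$-graph $X$ is a set $X_0$ of objects together with an object $X(a,b)$ of $V$ for all $a,b\in X_0$, and morphisms are given by an object map and hom maps. It is a category over $\mathbf{Set}$ via $X\mapsto X_0$. Let $0$ be the $V$-graph with one object and initial hom. Let $T$ be an accessible monad on $\mathcal{G}V$ over $\mathbf{Set}$, i.e. $(TX)_0=X_0$ (strictly, functorially in $X$) and the unit and multiplication of $T$ are identities on objects. Call $T$ \emph{well-pointed} when $T0$ is terminal. For $T$-algebras $X_1,\dots,X_n,Y$, a \emph{multimap} $f:(X_i)_i\to Y$ consists of a function $f_0:\prod_i X_{i,0}\to Y_0$ and, for each $j$ and each $z\in\prod_{i\neq j}X_{i,0}$, a $T$-algebra morphism $f_z:X_j\to Y$ with object map $f_0$ restricted by fixing the other variables at $z$. The \emph{free product} $\bigotimes_i X_i$ is the tensor product of $T$-algebras which classifies multimaps: it comes with a strongly universal multimap $\alpha:(X_i)_i\to\bigotimes_i X_i$ (composition with $\alpha$ is bijective, also in the presence of further variables). Its unit $I$ is the nullary case. Then the following hold. (1) One may choose the free products and the cartesian products of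 all finite sequences of $T$-algebras so that $\bigotimes_iX_i$ and $\prod_iX_i$ both have object set $\prod_i X_{i,0}$, with the universal multimaps being identities on objects and the product projections being the projections on objects, and so that moreover, if $T$ is well-pointed, then the unit $I$ is terminal and for every finite sequence $(X_i)_i$ of $T$-algebras the canonical comparison map $$\kappa:\bigotimes_i X_i\to\prod_i X_i$$ is the identity on objects. Here $\kappa$ is the map whose composite with the $j$-th projection is, for every $j$, the composite of $\bigotimes_i X_i\to\bigotimes(I,\dots,I,X_j,I,\dots,I)$, the tensor product of the identity of $X_j$ with the unique maps $X_i\to I$ ($i\ne j$), and the unit coherence isomorphism $\bigotimes(I,\dots,I,X_j,I,\dots,I)\cong X_j$. (2) For any choice of free products and cartesian products, if for all $T$-algebras $A,B$ there is some $T$-algebra morphism $A\otimes B\to A\times B$, then the unit of the free product, which is isomorphic to the free $T$-algebra $(T0,\mu_0)$, is terminal; that is, $(T0,\mu_0)$ is a terminal $T$-algebra. -/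

import Mathlib

open CategoryTheory CategoryTheory.Limits

universe w v u

/-! ### Graphs enriched in a category -/

/-- A graph enriched in `V`: a set of objects, and an object of `V` for each ordered pair of
objects. -/
structure VGraph (V : Type u) : Type (max u (w + 1)) where
  Obj : Type w
  Edge : Obj → Obj → V

namespace VGraph

variable {V : Type u} [Category.{v} V]

/-- A morphism of `V`-graphs: an object map and hom maps. -/
@[ext]
structure Hom (X Y : VGraph.{w} V) where
  obj : X.Obj → Y.Obj
  edge : ∀ a b : X.Obj, X.Edge a b ⟶ Y.Edge (obj a) (obj b)

instance : Category (VGraph.{w} V) where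
  Hom := Hom
  id X := ⟨fun a => a, fun _ _ => 𝟙 _⟩
  comp f g := ⟨fun a => g.obj (f.obj a), fun a b => f.edge a b ≫ g.edge (f.obj a) (f.obj b)⟩
  id_comp f := by simp
  comp_id f := by simp
  assoc f g h := by simp

variable (V) in
/-- The functor sending a `V`-graph to its set of objects. It makes the category of `V`-graphs a
category over `Set`. -/
def objects : VGraph.{w} V ⥤ Type w where
  obj X := X.Obj
  map f := TypeCat.ofHom f.obj
  map_id _ := rfl
  map_comp _ _ := rfl

variable (V) in
/-- The `V`-graph `0`, with one object and initial hom. -/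
noncomputable def zero [HasInitial V] : VGraph.{w} V where
  Obj := PUnit
  Edge _ _ := ⊥_ V

end VGraph

/-- A function is an identity: its source and target are the same set and it fixes each
element. -/
def IsIdentity {α β : Type w} (f : α → β) : Prop :=
  ∃ h : α = β, ∀ x, f x = cast h x

/-! ### The multimaps of a category over `Set` -/

/-- Replace (or supply) the `i`-th coordinate of a family. -/
def insertAt {ι : Type} [DecidableEq ι] {F : ι → Type w} (i : ι)
    (z : ∀ k : {k // k ≠ i}, F k) (a : F i) : ∀ k, F k :=
  fun k => if h : k = i then h.symm ▸ a else z ⟨k, h⟩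

theorem insertAt_self {ι : Type} [DecidableEq ι] {F : ι → Type w} (i : ι)
    (z : ∀ k : {k // k ≠ i}, F k) (a : F i) : insertAt i z a i = a := by
  simp [insertAt]

theorem insertAt_ne {ι : Type} [DecidableEq ι] {F : ι → Type w} (i : ι)
    (z : ∀ k : {k // k ≠ i}, F k) (a : F i) (k : ι) (h : k ≠ i) :
    insertAt i z a k = z ⟨k, h⟩ := by
  simp [insertAt, h]

section

variable {A : Type u} [Category.{v} A] (U : A ⥤ Type w)

/-- A multimap `(X_i)_i → b` in the symmetric multicategory `ℱA` of a category `A` over `Set`: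
an underlying multifunction, together with, for each input variable `i` and each choice `z` of
elements in all variables but the `i`-th, a morphism `X_i ⟶ b` of `A` (a linear part) whose
underlying function is the multifunction with the other variables fixed at `z`.
Families are indexed by arbitrary types `ι`, so that the symmetric group actions are
reindexings. -/
@[ext]
structure Multimap {ι : Type} [DecidableEq ι] (X : ι → A) (b : A) where
  fn : (∀ i, U.obj (X i)) → U.obj b
  lin : ∀ (i : ι) (_ : ∀ k : {k // k ≠ i}, U.obj (X k)), X i ⟶ b
  map_lin : ∀ (i : ι) (z : ∀ k : {k // k ≠ i}, U.obj (X k)) (a : U.obj (X i)),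
    U.map (lin i z) a = fn (insertAt (F := fun k => U.obj (X k)) i z a)

variable {U}

namespace Multimap

variable {ι : Type} [DecidableEq ι] {X Y : ι → A} {b c : A}

/-- The composite of a multimap with a linear map out of its target. -/
def postcomp (f : Multimap U X b) (h : b ⟶ c) : Multimap U X c where
  fn x := U.map h (f.fn x)
  lin i z := f.lin i z ≫ h
  map_lin i z a := by simp [f.map_lin]

/-- The composite of a multimap with a family of linear maps into its inputs. -/
def precomp (f : Multimap U Y b) (g : ∀ i, X i ⟶ Y i) : Multimap U X b where
  fn x := f.fn fun i => U.map (g i) (x i)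
  lin i z := g i ≫ f.lin i fun k => U.map (g k) (z k)
  map_lin i z a := by
    simp only [Functor.map_comp, types_comp_apply, f.map_lin]
    congr 1
    funext k
    by_cases hk : k = i
    · subst hk
      simp [insertAt_self]
    · simp [insertAt_ne, hk]

/-- The placed composite: substitute the multimap `f : (X_i)_i → b` for the last variable of the
multimap `g : (C_1, ..., C_m, b) → c`, obtaining a multimap `(C_1, ..., C_m, (X_i)_i) → c`. -/
def placed {m : ℕ} {C : Fin m → A}
    (g : Multimap U (Sum.elim C fun _ : Unit => b) c) (f : Multimap U X b) :
    Multimap U (Sum.elim C X) c where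
  fn x := g.fn fun s => match s with
    | Sum.inl k => x (Sum.inl k)
    | Sum.inr () => f.fn fun i => x (Sum.inr i)
  lin s := match s with
    | Sum.inl k => fun z => g.lin (Sum.inl k) fun t => match t with
      | ⟨Sum.inl l, hl⟩ => z ⟨Sum.inl l, fun e => hl (by rw [Sum.inl.inj e])⟩
      | ⟨Sum.inr (), _⟩ => f.fn fun i => z ⟨Sum.inr i, by simp⟩
    | Sum.inr i => fun z =>
      f.lin i (fun k => z ⟨Sum.inr k.1, fun e => k.2 (Sum.inr.inj e)⟩) ≫
        g.lin (Sum.inr ()) fun t => match t with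
          | ⟨Sum.inl l, _⟩ => z ⟨Sum.inl l, by simp⟩
          | ⟨Sum.inr (), h⟩ => absurd rfl h
  map_lin s z a := by
    match s with
    | Sum.inl k =>
      refine (g.map_lin (Sum.inl k) _ a).trans (congrArg g.fn (funext fun t => ?_))
      match t with
      | Sum.inl l =>
        by_cases hl : l = k
        · subst hl
          exact (insertAt_self _ _ _).trans (insertAt_self (F := fun s => U.obj (Sum.elim C X s)) _ z a).symm
        · have hl' : (Sum.inl l : Fin m ⊕ Unit) ≠ Sum.inl k := fun e => hl (Sum.inl.inj e)
          have hl'' : (Sum.inl l : Fin m ⊕ ι) ≠ Sum.inl k := fun e => hl (Sum.inl.inj e)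
          exact (insertAt_ne _ _ _ _ hl').trans (insertAt_ne (F := fun s => U.obj (Sum.elim C X s)) _ z a _ hl'').symm
      | Sum.inr () =>
        refine (insertAt_ne _ _ _ _ Sum.inr_ne_inl).trans (congrArg f.fn (funext fun l => ?_))
        exact (insertAt_ne (F := fun s => U.obj (Sum.elim C X s)) _ z a _ Sum.inr_ne_inl).symm
    | Sum.inr i =>
      refine (ConcreteCategory.congr_hom (U.map_comp _ _) a).trans ?_
      refine (g.map_lin (Sum.inr ()) _ _).trans (congrArg g.fn (funext fun t => ?_))
      match t with
      | Sum.inl l =>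
        exact (insertAt_ne _ _ _ _ Sum.inl_ne_inr).trans
          (insertAt_ne (F := fun s => U.obj (Sum.elim C X s)) _ z a _ Sum.inl_ne_inr).symm
      | Sum.inr () =>
        refine (insertAt_self _ _ _).trans ?_
        refine (f.map_lin i _ a).trans (congrArg f.fn (funext fun l => ?_))
        by_cases hl : l = i
        · subst hl
          exact (insertAt_self _ _ _).trans (insertAt_self (F := fun s => U.obj (Sum.elim C X s)) _ z a).symm
        · have hl' : (Sum.inr l : Fin m ⊕ ι) ≠ Sum.inr i := fun e => hl (Sum.inr.inj e)
          exact (insertAt_ne _ _ _ _ hl).trans (insertAt_ne (F := fun s => U.obj (Sum.elim C X s)) _ z a _ hl').symm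

/-- A multimap is universal when every multimap out of its inputs factors uniquely through it by
a linear map. -/
def IsUniversal (f : Multimap U X b) : Prop :=
  ∀ c : A, Function.Bijective fun h : b ⟶ c => f.postcomp h

/-- A multimap is strongly universal when it is universal and moreover placed composition with
it is bijective in the presence of arbitrary further variables. (Since all permutations of the
variables act, the substituted variable may be taken to be the last.) -/
def IsStronglyUniversal (f : Multimap U X b) : Prop :=
  f.IsUniversal ∧ ∀ (m : ℕ) (C : Fin m → A) (c : A),
    Function.Bijective fun g : Multimap U (Sum.elim C fun _ : Unit => b) c => g.placed f

end Multimap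

variable (U) in
/-- A choice of tensor products of finite sequences in the multicategory `ℱA`: for each sequence
a strongly universal multimap out of it. This is what the (symmetric) monoidal structure induced
by the representability of `ℱA` consists of. -/
structure TensorChoice where
  tensor : ∀ {n : ℕ}, (Fin n → A) → A
  univ : ∀ {n : ℕ} (X : Fin n → A), Multimap U X (tensor X)
  strong : ∀ {n : ℕ} (X : Fin n → A), (univ X).IsStronglyUniversal

namespace TensorChoice

variable (R : TensorChoice U)

/-- The unit: the nullary tensor product. -/
def unit : A := R.tensor (n := 0) fun i => i.elim0

/-- The universal nullary multimap `() → unit`, which is the same as an element of the unit. -/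
def unitPt : U.obj R.unit := (R.univ (n := 0) fun i => i.elim0).fn fun i => i.elim0

/-- The tensor product `⨂ g_i : ⨂ X_i ⟶ ⨂ Y_i` of a sequence of morphisms: the unique one with
`(⨂ g_i) ∘ univ = univ ∘ (g_i)_i`. -/
noncomputable def map {n : ℕ} {X Y : Fin n → A} (g : ∀ i, X i ⟶ Y i) : R.tensor X ⟶ R.tensor Y :=
  (Equiv.ofBijective _ ((R.strong X).1 (R.tensor Y))).symm ((R.univ Y).precomp g)

/-- The sequence `(I, ..., I, X_j, I, ..., I)` with `I` the unit and `X_j` in position `j`. -/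
def single {n : ℕ} (X : Fin n → A) (j : Fin n) : Fin n → A :=
  fun i => if i = j then X i else R.unit

/-- The canonical map `X_j ⟶ ⨂ (I, ..., I, X_j, I, ..., I)`: the linear part of the universal
multimap at the unit elements, i.e. its composite with the universal maps `() → I` in all the
positions `i ≠ j`. -/
def singleIncl {n : ℕ} (X : Fin n → A) (j : Fin n) : X j ⟶ R.tensor (R.single X j) :=
  eqToHom (if_pos rfl).symm ≫
    (R.univ (R.single X j)).lin j fun k =>
      U.map (eqToHom (if_neg k.2).symm) R.unitPt

/-- The family of maps `(X_i)_i ⟶ (I, ..., I, X_j, I, ..., I)` which is the identity in position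
`j` and the unique map into the unit in the other positions, when the unit is terminal. -/
def singleProj (hI : IsTerminal R.unit) {n : ℕ} (X : Fin n → A) (j : Fin n) (i : Fin n) :
    X i ⟶ R.single X j i :=
  if h : i = j then eqToHom (if_pos h).symm
  else hI.from (X i) ≫ eqToHom (if_neg h).symm

/-- `κ : ⨂ X_i ⟶ ∏ X_i` is the canonical comparison map (the unit being terminal): for all `j`
the composite `p_j κ` is
`⨂ X_i ⟶ ⨂ (I, ..., I, X_j, I, ..., I) ≅ X_j`, where the first map is the tensor product of the
identity of `X_j` with the unique maps into `I`, and the second is the unit coherence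
isomorphism, i.e. the inverse of the canonical map `singleIncl`. -/
def IsComparison (hI : IsTerminal R.unit) {n : ℕ} {X : Fin n → A} (c : Fan X)
    (κ : R.tensor X ⟶ c.pt) : Prop :=
  ∀ j : Fin n, ∃ e : X j ≅ R.tensor (R.single X j), e.hom = R.singleIncl X j ∧
    κ ≫ c.proj j = R.map (R.singleProj hI X j) ≫ e.inv

end TensorChoice

end

/-! ### Monads over `Set` -/

section

variable {V : Type u} [Category.{v} V]

/-- A monad on the category of `V`-graphs is over `Set` when its functor part commutes strictly
with the functor to sets of objects, and its unit and multiplication are identities on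
objects. -/
structure IsOverSet (T : Monad (VGraph.{w} V)) : Prop where
  comp_objects : T.toFunctor ⋙ VGraph.objects V = VGraph.objects V
  unit : ∀ X, IsIdentity ((VGraph.objects V).map (T.η.app X))
  mult : ∀ X, IsIdentity ((VGraph.objects V).map (T.μ.app X))

/-- A monad on `V`-graphs is well-pointed when `T0` is terminal. -/
def IsWellPointed [HasInitial V] (T : Monad (VGraph.{w} V)) : Prop :=
  Nonempty (IsTerminal (T.toFunctor.obj (VGraph.zero V)))

/-- The category of `T`-algebras as a category over `Set`, by taking the set of objects of the
underlying `V`-graph. -/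
def algObjects (T : Monad (VGraph.{w} V)) : T.Algebra ⥤ Type w :=
  T.forget ⋙ VGraph.objects V

end

theorem hasInitial_of_isLocallyPresentable (V : Type u) [Category.{w} V]
    [IsLocallyPresentable.{w} V] : HasInitial V := by
  obtain ⟨κ, _, _⟩ := IsLocallyPresentable.exists_cardinal.{w} V
  have : HasColimitsOfSize.{0, 0} V := hasColimitsOfSizeShrink.{0, 0, w, w} V
  infer_instance

attribute [instance] hasInitial_of_isLocallyPresentable

/-! The core is the construction of universal multimaps that are bijective on objects. Such a
multimap is automatically strongly universal (`Multimap.IsUniversal.isStronglyUniversal`): with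
further variables fixed one factors through it by universality, and an element of its target is the
same thing as a tuple of elements of the inputs.

To construct one out of `(X_i)`, let `P` be the product of the object sets. The fibre of `V`-graphs
over `P` is equivalent to a power of `V`, so it is cocomplete, and `T` restricts to an accessible
monad on it since its unit is bijective on objects. In this fibre let `W` be the sum, over all `j`
and all values `z` of the other variables, of the direct image of `X_j` along insertion at `z`. A
multimap into an algebra over `P` that is the identity on objects is a map out of `W` whose
restriction to each summand is an algebra morphism. The universal such algebra is a quotient of the
free algebra on `W` by a parallel pair; it exists by `Monad.exists_universal_coequalizing`, which
rests on a transfinite free algebra sequence. A target with other objects is reduced to this case by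
taking its inverse image along the object function (`pullbackAlgebra`).

The unit `I` represents the functor of objects, so it is the free algebra on `0`, and it has a
single object. Hence linear parts of universal multimaps whose other inputs are `I` are invertible,
and `κ` can be evaluated on objects, where it is the identity. If `T0` is terminal as a graph, the
free algebra on it is terminal. Conversely, given maps from tensor products to products, `1 ⟶ I ⊗ 1
⟶ I × 1 ⟶ I` goes from the terminal algebra to `I`, and `I ⟶ 1 ⟶ I` is the identity because `I` is
free on its only object. -/

theorem hasLimits_of_isLocallyPresentable (V : Type u) [Category.{w} V]
    [IsLocallyPresentable.{w} V] : HasLimitsOfSize.{w, w} V := by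
  obtain ⟨κ, _, _⟩ := IsLocallyPresentable.exists_cardinal.{w} V
  let P := isCardinalPresentable V κ
  let ι : SmallModel.{w} P.FullSubcategory ⥤ V := (equivSmallModel.{w} _).inverse ⋙ P.ι
  have : ι.IsDense :=
    (Functor.IsDense.comp_left_iff_of_isEquivalence P.ι (equivSmallModel.{w} _).inverse).2
      inferInstance
  -- The restricted Yoneda embedding along the dense subcategory of `κ`-presentable objects is fully
  -- faithful and has a left adjoint, so `V` is reflective in a presheaf category.
  let R := Presheaf.restrictedULiftYoneda.{w} ι
  have : (uliftYoneda.{w}).HasPointwiseLeftKanExtension ι := inferInstance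
  let adj := Presheaf.uliftYonedaAdjunction.{w} (uliftYoneda.{w}.leftKanExtension ι)
    (uliftYoneda.{w}.leftKanExtensionUnit ι)
  let _ : Reflective R := { L := _, adj := adj }
  exact hasLimits_of_reflective R

/-! ### Colimits in comma categories over the identity -/

section

variable {C : Type u} [Category.{v} C] {K : Type*} [Category K]

/-- A category `Comma L (𝟭 C)` has the colimits of shape `K` which exist in `C`, whether or not
`L` preserves them. -/
theorem Comma.hasColimitsOfShape_id (L : C ⥤ C) [HasColimitsOfShape K C] [HasPushouts C] :
    HasColimitsOfShape K (Comma L (𝟭 C)) where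
  has_colimit F := by
    let A := F ⋙ Comma.fst L (𝟭 C)
    let B := F ⋙ Comma.snd L (𝟭 C)
    let x : A ⋙ L ⟶ B := { 
      app k := (F.obj k).hom
      naturality k l f := (F.map f).w }
    let l : colimit (A ⋙ L) ⟶ L.obj (colimit A) := colimit.post A L
    let r : colimit (A ⋙ L) ⟶ colimit B := colimMap x
    have hl (k) : colimit.ι (A ⋙ L) k ≫ l = L.map (colimit.ι A k) := colimit.ι_post A L k
    have hr (k) : colimit.ι (A ⋙ L) k ≫ r = (F.obj k).hom ≫ colimit.ι B k := ι_colimMap x k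
    -- As `L` need not preserve the colimit, `l` need not be invertible; the pushout forces a
    -- structure map out of `L.obj (colimit A)`.
    let c : Cocone F := {
      pt := { left := colimit A, right := pushout l r, hom := pushout.inl l r }
      ι := {
        app k := {
          left := colimit.ι A k
          right := colimit.ι B k ≫ pushout.inr l r
          w := by
            change L.map (colimit.ι A k) ≫ pushout.inl l r =
              (F.obj k).hom ≫ colimit.ι B k ≫ pushout.inr l r
            rw [← hl, Category.assoc, pushout.condition, ← Category.assoc, hr, Category.assoc] }
        naturality k k' f := by
          ext
          · exact (colimit.w A f).trans (Category.comp_id _).symm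
          · exact (colimit.w_assoc B f _).trans (Category.comp_id _).symm } }
    refine ⟨⟨c, ⟨?_, ?_, ?_⟩⟩⟩
    · intro s
      refine {
        left := colimit.desc A ((Comma.fst L (𝟭 C)).mapCocone s)
        right := pushout.desc (L.map (colimit.desc A ((Comma.fst L (𝟭 C)).mapCocone s)) ≫ s.pt.hom)
          (colimit.desc B ((Comma.snd L (𝟭 C)).mapCocone s)) ?_
        w := (pushout.inl_desc _ _ _).symm }
      refine colimit.hom_ext fun k => ?_
      rw [← Category.assoc, hl, ← Category.assoc (colimit.ι _ k) r, hr, Category.assoc,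
        colimit.ι_desc, ← Category.assoc, ← L.map_comp, colimit.ι_desc]
      exact (s.ι.app k).w
    · intro s k
      ext
      · exact colimit.ι_desc _ _
      · exact (Category.assoc _ _ _).trans ((congrArg _ (pushout.inr_desc _ _ _)).trans
          (colimit.ι_desc _ _))
    · intro s m hm
      have h₁ : m.left = colimit.desc A ((Comma.fst L (𝟭 C)).mapCocone s) :=
        colimit.hom_ext fun k =>
          (congrArg CommaMorphism.left (hm k)).trans
            (colimit.ι_desc ((Comma.fst L (𝟭 C)).mapCocone s) k).symm
      refine CommaMorphism.ext h₁ (pushout.hom_ext ?_ (colimit.hom_ext fun k => ?_))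
      · refine m.w.symm.trans ?_
        rw [h₁]
        exact (pushout.inl_desc _ _ _).symm
      · refine ((Category.assoc _ _ _).symm.trans
          (congrArg CommaMorphism.right (hm k))).trans ?_
        dsimp only
        rw [pushout.inr_desc, colimit.ι_desc]
        rfl

end

/-! ### The free algebra sequence -/

namespace CategoryTheory.Monad

variable {C : Type u} [Category.{v} C] (T : Monad C)

/-- A morphism `T A ⟶ B`, regarded as an algebra structure which is only partially defined. -/
abbrev PartialAlgebra := Comma T.toFunctor (𝟭 C)

namespace PartialAlgebra

variable {T}

/-- The structure map of a partial algebra. -/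
def str (d : PartialAlgebra T) : T.obj d.left ⟶ d.right := d.hom

/-- The map `A ⟶ B` underlying a partial algebra `T A ⟶ B`. -/
def incl (d : PartialAlgebra T) : d.left ⟶ d.right := T.η.app d.left ≫ d.str

theorem hom_w {d e : PartialAlgebra T} (f : d ⟶ e) :
    T.map f.left ≫ e.str = d.str ≫ f.right := f.w

theorem incl_naturality {d e : PartialAlgebra T} (f : d ⟶ e) :
    f.left ≫ e.incl = d.incl ≫ f.right := by
  rw [incl, T.unit_naturality_assoc, hom_w, incl, Category.assoc]

/-- An algebra is a partial algebra. -/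
abbrev ofAlgebra (Z : T.Algebra) : PartialAlgebra T where
  left := Z.A
  right := Z.A
  hom := Z.a

@[simp]
theorem ofAlgebra_incl (Z : T.Algebra) : (ofAlgebra Z).incl = 𝟙 Z.A := Z.unit

/-- The partial algebras which are algebras. -/
def isAlgebra : ObjectProperty (PartialAlgebra T) := fun d => ∃ Z : T.Algebra, d = ofAlgebra Z

/-- A map of partial algebras into an algebra is determined by its second component. -/
theorem left_eq_of_hom {d : PartialAlgebra T} {Z : T.Algebra} (f : d ⟶ ofAlgebra Z) :
    f.left = d.incl ≫ f.right := by
  have h := incl_naturality f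
  rw [ofAlgebra_incl] at h
  exact (Category.comp_id _).symm.trans h

variable [HasCoequalizers C]

/-- The target of the structure map of the next step of the free algebra sequence. -/
noncomputable def nextObj (d : PartialAlgebra T) : C :=
  coequalizer (T.map d.str) (T.μ.app d.left ≫ T.map d.incl)

/-- The structure map of the next step of the free algebra sequence. -/
noncomputable def nextHom (d : PartialAlgebra T) : T.obj d.right ⟶ d.nextObj :=
  coequalizer.π (T.map d.str) (T.μ.app d.left ≫ T.map d.incl)

/-- The next step of the free algebra sequence. -/
noncomputable abbrev next (d : PartialAlgebra T) : PartialAlgebra T where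
  left := d.right
  right := d.nextObj
  hom := d.nextHom

theorem nextHom_condition (d : PartialAlgebra T) :
    T.map d.str ≫ d.nextHom = T.μ.app d.left ≫ T.map d.incl ≫ d.nextHom :=
  (coequalizer.condition (T.map d.str) (T.μ.app d.left ≫ T.map d.incl)).trans
    (Category.assoc _ _ _)

theorem nextHom_condition_assoc (d : PartialAlgebra T) {X : C} (f : d.nextObj ⟶ X) :
    T.map d.str ≫ d.nextHom ≫ f = T.μ.app d.left ≫ T.map d.incl ≫ d.nextHom ≫ f := by
  rw [← Category.assoc, nextHom_condition, Category.assoc, Category.assoc]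

/-- The comparison of a partial algebra with the next step of the free algebra sequence. -/
noncomputable def toNext (d : PartialAlgebra T) : d ⟶ d.next where
  left := d.incl
  right := d.next.incl
  w := by
    have h : T.η.app (T.obj d.left) ≫ T.map d.str ≫ d.nextHom =
        T.η.app (T.obj d.left) ≫ T.μ.app d.left ≫ T.map d.incl ≫ d.nextHom := by
      rw [d.nextHom_condition]
    exact ((Monad.unit_naturality_assoc _ T d.str d.nextHom).trans
      (h.trans (T.left_unit_assoc _ _))).symm

/-- For a map `f` into an algebra `Z`, associativity of `Z` says exactly that `T.map f.right ≫ Z.a`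
coequalizes the pair defining `nextObj`. So `f` extends to `next`, uniquely because maps into
algebras are determined by their second component. -/
theorem isLocal_toNext (d : PartialAlgebra T) : isAlgebra.isLocal d.toNext := by
  rintro _ ⟨Z, rfl⟩
  constructor
  · intro f g h
    have hl : f.left = g.left := by
      have := congrArg CommaMorphism.right h
      rw [left_eq_of_hom f, left_eq_of_hom g]
      exact this
    refine CommaMorphism.ext hl (coequalizer.hom_ext ?_)
    have h₁ := hom_w f
    rw [hl] at h₁
    exact h₁.symm.trans (hom_w g)
  · intro f
    have hf : T.map f.left ≫ Z.a = d.str ≫ f.right := hom_w f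
    have hk : T.map d.str ≫ T.map f.right ≫ Z.a =
        (T.μ.app d.left ≫ T.map d.incl) ≫ T.map f.right ≫ Z.a := by
      rw [← T.map_comp_assoc, ← hf, T.map_comp, Category.assoc, ← Z.assoc,
        Category.assoc, ← T.map_comp_assoc, ← left_eq_of_hom f, T.mu_naturality_assoc]
    let g : d.next ⟶ ofAlgebra Z := {
      left := f.right
      right := coequalizer.desc (T.map f.right ≫ Z.a) hk
      w := (coequalizer.π_desc _ hk).symm }
    exact ⟨g, CommaMorphism.ext (left_eq_of_hom f).symm (left_eq_of_hom g).symm⟩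

end PartialAlgebra

variable {T}

instance [HasColimitsOfSize.{w, w} C] : HasColimitsOfSize.{w, w} (PartialAlgebra T) :=
  have : HasFiniteColimits C := hasFiniteColimits_of_hasColimitsOfSize.{w, w} C
  ⟨fun _ _ => Comma.hasColimitsOfShape_id _⟩

namespace PartialAlgebra

section

variable [HasCoequalizers C] [HasColimitsOfSize.{w, w} C]
  {J : Type w} [LinearOrder J] [OrderBot J] [SuccOrder J] [WellFoundedLT J]
  (d : PartialAlgebra T)

/-- The free algebra sequence, as an iteration of the steps `next`. -/
noncomputable def succStruct : SmallObject.SuccStruct (PartialAlgebra T) where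
  X₀ := d
  succ := next
  toSucc := toNext

variable (J) in
/-- The free algebra sequence starting at `d`. -/
noncomputable abbrev sequence : J ⥤ PartialAlgebra T := d.succStruct.iterationFunctor J

variable (J) in
/-- The colimit of the free algebra sequence. -/
noncomputable abbrev seqColimit : PartialAlgebra T := d.succStruct.iteration J

/-- The canonical map of a term of the free algebra sequence into the colimit. -/
noncomputable abbrev seqι (j : J) : (d.sequence J).obj j ⟶ d.seqColimit J :=
  (d.succStruct.iterationCocone J).ι.app j

theorem seqι_w {i j : J} (h : i ≤ j) : (d.sequence J).map (homOfLE h) ≫ d.seqι j = d.seqι i :=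
  (d.succStruct.iterationCocone J).w (homOfLE h)

variable [NoMaxOrder J]

/-- The second component of a term of the free algebra sequence is the first component of the
next one. -/
noncomputable def shift (j : J) :
    ((d.sequence J).obj j).right ⟶ ((d.sequence J).obj (Order.succ j)).left :=
  (d.succStruct.iterationFunctorObjSuccIso j (not_isMax j)).inv.left

theorem sequence_map_succ (j : J) : (d.sequence J).map (homOfLE (Order.le_succ j)) =
    toNext _ ≫ (d.succStruct.iterationFunctorObjSuccIso j (not_isMax j)).inv :=
  d.succStruct.iterationFunctor_map_succ j (not_isMax j)

theorem incl_shift (j : J) : ((d.sequence J).obj j).incl ≫ d.shift j =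
    ((d.sequence J).map (homOfLE (Order.le_succ j))).left :=
  (congrArg CommaMorphism.left (d.sequence_map_succ j)).symm

theorem shift_incl (j : J) : d.shift j ≫ ((d.sequence J).obj (Order.succ j)).incl =
    ((d.sequence J).map (homOfLE (Order.le_succ j))).right :=
  (incl_naturality _).trans (congrArg CommaMorphism.right (d.sequence_map_succ j)).symm

theorem map_shift_str (j : J) : T.map (d.shift j) ≫ ((d.sequence J).obj (Order.succ j)).str =
    ((d.sequence J).obj j).nextHom ≫
      (d.succStruct.iterationFunctorObjSuccIso j (not_isMax j)).inv.right :=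
  hom_w (d.succStruct.iterationFunctorObjSuccIso j (not_isMax j)).inv

/-- The map from the second component of a term of the free algebra sequence into the first
component of the colimit. -/
noncomputable def shiftι (j : J) : ((d.sequence J).obj j).right ⟶ (d.seqColimit J).left :=
  d.shift j ≫ (d.seqι (Order.succ j)).left

theorem incl_shiftι (j : J) :
    ((d.sequence J).obj j).incl ≫ d.shiftι j = (d.seqι j).left := by
  rw [shiftι, ← Category.assoc, incl_shift]
  exact congrArg CommaMorphism.left (d.seqι_w (Order.le_succ j))

theorem shiftι_incl (j : J) :
    d.shiftι j ≫ (d.seqColimit J).incl = (d.seqι j).right := by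
  rw [shiftι, Category.assoc, incl_naturality, ← Category.assoc, shift_incl]
  exact congrArg CommaMorphism.right (d.seqι_w (Order.le_succ j))

theorem map_right_shiftι {i j : J} (h : i ≤ j) :
    ((d.sequence J).map (homOfLE h)).right ≫ d.shiftι j = d.shiftι i := by
  -- No induction is needed: for `i < j` the transition map factors through the stage `Order.succ
  -- i`.
  obtain rfl | h' := h.eq_or_lt
  · have e : (d.sequence J).map (homOfLE h) = 𝟙 _ := (d.sequence J).map_id i
    rw [e]
    exact Category.id_comp _
  · have h₂ := Order.succ_le_of_lt h'
    have e : (d.sequence J).map (homOfLE h) =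
        (d.sequence J).map (homOfLE (Order.le_succ i)) ≫ (d.sequence J).map (homOfLE h₂) := by
      rw [← Functor.map_comp]
      rfl
    rw [e, Comma.comp_right, ← shift_incl, Category.assoc, Category.assoc,
      ← Category.assoc (incl _), ← incl_naturality, Category.assoc, incl_shiftι, shiftι]
    exact congrArg (_ ≫ ·) (congrArg CommaMorphism.left (d.seqι_w h₂))

variable [PreservesColimitsOfShape J T.toFunctor]

/-- The components of the colimit of the free algebra sequence are colimits. -/
noncomputable def isColimitRight :
    IsColimit ((Comma.snd T.toFunctor (𝟭 C)).mapCocone (d.succStruct.iterationCocone J)) :=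
  isColimitOfPreserves _ (d.succStruct.isColimitIterationCocone J)

noncomputable def isColimitLeft :
    IsColimit ((Comma.fst T.toFunctor (𝟭 C)).mapCocone (d.succStruct.iterationCocone J)) :=
  isColimitOfPreserves _ (d.succStruct.isColimitIterationCocone J)

variable (J) in
/-- The inverse of the underlying map of the colimit of the free algebra sequence. -/
noncomputable def retract : (d.seqColimit J).right ⟶ (d.seqColimit J).left :=
  d.isColimitRight.desc {
    pt := (d.seqColimit J).left
    ι := {
      app := d.shiftι
      naturality _ _ f := (d.map_right_shiftι (leOfHom f)).trans (Category.comp_id _).symm } }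

theorem seqι_retract (j : J) : (d.seqι j).right ≫ d.retract J = d.shiftι j :=
  d.isColimitRight.fac _ j

/-- The first components and the second components form interleaved chains, so they have the same
colimit. -/
theorem incl_retract : (d.seqColimit J).incl ≫ d.retract J = 𝟙 _ := by
  refine d.isColimitLeft.hom_ext fun j => ?_
  change (d.seqι j).left ≫ _ = (d.seqι j).left ≫ _
  rw [← Category.assoc, incl_naturality, Category.assoc, seqι_retract, incl_shiftι,
    Category.comp_id]

theorem retract_incl : d.retract J ≫ (d.seqColimit J).incl = 𝟙 _ := by
  refine d.isColimitRight.hom_ext fun j => ?_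
  change (d.seqι j).right ≫ _ = (d.seqι j).right ≫ _
  rw [← Category.assoc, seqι_retract, shiftι_incl, Category.comp_id]

/-- Associativity, up to the invertible `retract`. As `T` preserves the colimit it may be tested at
each stage, where it is the relation imposed by the coequalizer at the next stage. -/
theorem map_str_retract_str :
    T.map ((d.seqColimit J).str ≫ d.retract J) ≫ (d.seqColimit J).str =
      T.μ.app _ ≫ (d.seqColimit J).str := by
  have hc := isColimitOfPreserves T.toFunctor
    (isColimitOfPreserves T.toFunctor (d.isColimitLeft (J := J)))
  refine hc.hom_ext fun j => ?_
  change T.map (T.map (d.seqι j).left) ≫ _ = T.map (T.map (d.seqι j).left) ≫ _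
  have h₁ : T.map (d.shiftι j) ≫ (d.seqColimit J).str = ((d.sequence J).obj j).nextHom ≫
      (d.succStruct.iterationFunctorObjSuccIso j (not_isMax j)).inv.right ≫
        (d.seqι (Order.succ j)).right := by
    rw [shiftι, T.map_comp, Category.assoc, hom_w, ← Category.assoc, map_shift_str]
    exact Category.assoc _ _ _
  rw [← T.map_comp_assoc, ← Category.assoc (T.map _), hom_w, Category.assoc, seqι_retract,
    T.mu_naturality_assoc, ← incl_shiftι, T.map_comp, T.map_comp, Category.assoc, Category.assoc,
    h₁, nextHom_condition_assoc]

variable (J) in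
/-- The colimit of the free algebra sequence is an algebra. -/
noncomputable def colimitAlgebra : T.Algebra where
  A := (d.seqColimit J).left
  a := (d.seqColimit J).str ≫ d.retract J
  unit := (Category.assoc _ _ _).symm.trans d.incl_retract
  assoc := by
    rw [← Category.assoc (T.map _), map_str_retract_str, Category.assoc]

variable (J) in
noncomputable def colimitIso : d.seqColimit J ≅ ofAlgebra (d.colimitAlgebra J) :=
  Comma.isoMk (Iso.refl _) ⟨d.retract J, (d.seqColimit J).incl, d.retract_incl, d.incl_retract⟩ (by
    change T.map (𝟙 _) ≫ (d.seqColimit J).str ≫ d.retract J = _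
    rw [T.map_id, Category.id_comp]
    rfl)

end

variable [HasCoequalizers C] [HasColimitsOfSize.{w, w} C] [T.toFunctor.IsAccessible.{w}]

/-- Each step of the sequence is inverted by homs into algebras, hence so is the transfinite
composite. Its target is an algebra once the chain is long enough for `T` to preserve its colimit.
-/
theorem exists_reflection (d : PartialAlgebra T) :
    ∃ (Z : T.Algebra) (r : d ⟶ ofAlgebra Z), isAlgebra.isLocal r := by
  obtain ⟨κ, _, _⟩ := Functor.IsAccessible.exists_cardinal (F := T.toFunctor)
  let J := κ.ord.ToType
  have : Nonempty J := by simpa [J] using Cardinal.IsRegular.ne_zero Fact.out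
  have : OrderBot J := WellFoundedLT.toOrderBot J
  have : NoMaxOrder J := Cardinal.noMaxOrder (Fact.elim inferInstance : κ.IsRegular).aleph0_le
  have : PreservesColimitsOfShape J T.toFunctor :=
    T.toFunctor.preservesColimitsOfShape_of_isCardinalAccessible κ J
  let : SuccOrder J := inferInstance
  refine ⟨d.colimitAlgebra J, d.succStruct.ιIteration J ≫ (d.colimitIso J).hom,
    isAlgebra.isLocal.comp_mem _ _ ?_ ?_⟩
  · refine isAlgebra.isLocal.transfiniteCompositionsOfShape_le J _
      ⟨(d.succStruct.transfiniteCompositionOfShapeιIteration J).ofLE ?_⟩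
    rintro e _ _ ⟨_⟩
    exact isLocal_toNext e
  · exact isAlgebra.isLocal_of_isIso _

end PartialAlgebra

/-- The quotient of the free algebra on `W` by a pair of maps into its underlying object. -/
theorem exists_universal_coequalizing [HasColimitsOfSize.{w, w} C] [T.toFunctor.IsAccessible.{w}]
    {W' W : C} (f g : W' ⟶ T.obj W) :
    ∃ (Z : T.Algebra) (h : W ⟶ Z.A), f ≫ T.map h ≫ Z.a = g ≫ T.map h ≫ Z.a ∧
      ∀ (Y : T.Algebra) (k : W ⟶ Y.A), f ≫ T.map k ≫ Y.a = g ≫ T.map k ≫ Y.a →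
        ∃! l : Z ⟶ Y, h ≫ l.f = k := by
  have : HasFiniteColimits C := hasFiniteColimits_of_hasColimitsOfSize.{w, w} C
  -- Maps from `d` to an algebra `Y` are precisely the maps `k : W ⟶ Y.A` that satisfy the equation,
  -- so the reflection of `d` is the required quotient.
  let d : PartialAlgebra T := { left := W, right := coequalizer f g, hom := coequalizer.π f g }
  obtain ⟨Z, r, hr⟩ := PartialAlgebra.exists_reflection d
  have hw {Y : T.Algebra} (s : d ⟶ PartialAlgebra.ofAlgebra Y) :
    T.map s.left ≫ Y.a = coequalizer.π f g ≫ s.right := s.w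
  refine ⟨Z, r.left, by rw [hw, coequalizer.condition_assoc], fun Y k hk => ?_⟩
  let s : d ⟶ PartialAlgebra.ofAlgebra Y := {
    left := k
    right := coequalizer.desc (T.map k ≫ Y.a) hk
    w := (coequalizer.π_desc _ hk).symm }
  obtain ⟨t, ht⟩ := (hr _ ⟨Y, rfl⟩).2 s
  refine ⟨⟨t.left, ?_⟩, congrArg CommaMorphism.left ht, fun l hl => ?_⟩
  · have h := PartialAlgebra.left_eq_of_hom t
    rw [PartialAlgebra.ofAlgebra_incl, Category.id_comp] at h
    have := PartialAlgebra.hom_w t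
    rw [← h] at this
    exact this
  · let t' : PartialAlgebra.ofAlgebra Z ⟶ PartialAlgebra.ofAlgebra Y := ⟨l.f, l.f, l.h⟩
    have : t' = t := (hr _ ⟨Y, rfl⟩).1 (by
      refine Eq.trans ?_ ht.symm
      have h : (r ≫ t').left = s.left := hl
      refine CommaMorphism.ext h (coequalizer.hom_ext ?_)
      exact (hw (r ≫ t')).symm.trans ((congrArg (T.map · ≫ Y.a) h).trans (hw s)))
    ext
    exact congrArg CommaMorphism.left this

end CategoryTheory.Monad

/-! ### Products, inverse images and fibres of `V`-graphs -/

namespace VGraph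

variable {V : Type u}

theorem edge_eq {X : VGraph.{w} V} {a a' b b' : X.Obj} (ha : a = a') (hb : b = b') :
    X.Edge a b = X.Edge a' b' := by rw [ha, hb]

variable [Category.{v} V]

@[simp] theorem comp_obj {X Y Z : VGraph.{w} V} (f : X ⟶ Y) (g : Y ⟶ Z) (a : X.Obj) :
    Hom.obj (f ≫ g) a = g.obj (f.obj a) := rfl

theorem hom_ext {X Y : VGraph.{w} V} {f g : X ⟶ Y} (h : ∀ a, f.obj a = g.obj a)
    (h' : ∀ a b, f.edge a b ≫ eqToHom (edge_eq (h a) (h b)) = g.edge a b) : f = g := by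
  obtain ⟨fo, fe⟩ := f
  obtain ⟨go, ge⟩ := g
  obtain rfl : fo = go := funext h
  congr
  funext a b
  simpa using h' a b

theorem comp_eqToHom_cancel {A B C : V} (f : A ⟶ B) (h : B = C) (h' : C = B) :
    (f ≫ eqToHom h) ≫ eqToHom h' = f := by
  subst h
  simp

theorem congr_edge {X Y : VGraph.{w} V} {f g : X ⟶ Y} (h : f = g) (a b : X.Obj) :
    f.edge a b ≫ eqToHom (by rw [h]) = g.edge a b := by
  subst h
  simp

/-! ### Products -/

section

variable {ι : Type} (K : Discrete ι ⥤ VGraph.{w} V) [HasProductsOfShape ι V]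

/-- The product of a family of `V`-graphs. Its set of objects is the product of the sets of
objects. -/
noncomputable def productCone : Cone K where
  pt := {
    Obj := ∀ i : ι, (K.obj ⟨i⟩).Obj
    Edge := fun a b => ∏ᶜ fun i => (K.obj ⟨i⟩).Edge (a i) (b i) }
  π := Discrete.natTrans fun i => {
    obj := fun a => a i.as
    edge := fun _ _ => Pi.π _ i.as }

variable {K} in
theorem productCone_hom_ext {X : VGraph.{w} V} {m m' : X ⟶ (productCone K).pt}
    (h : ∀ i, m ≫ (productCone K).π.app i = m' ≫ (productCone K).π.app i) : m = m' := by
  have ho : m.obj = m'.obj := funext fun a => funext fun i => congrFun (congrArg Hom.obj (h ⟨i⟩)) a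
  obtain ⟨fo, fe⟩ := m
  obtain ⟨go, ge⟩ := m'
  obtain rfl : fo = go := ho
  congr
  funext a b
  refine Pi.hom_ext _ _ fun i => ?_
  exact (Category.comp_id _).symm.trans (congr_edge (h ⟨i⟩) a b)

/-- The product cone is a limit cone. -/
noncomputable def isLimitProductCone : IsLimit (productCone K) :=
  have fac (s : Cone K) (i : Discrete ι) : Hom.mk (Y := (productCone K).pt)
      (fun a i => (s.π.app ⟨i⟩).obj a)
      (fun a b => Pi.lift fun i => (s.π.app ⟨i⟩).edge a b) ≫ (productCone K).π.app i =
        s.π.app i :=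
    hom_ext (fun _ => rfl) fun _ _ => (Category.comp_id _).trans (Pi.lift_π _ _)
  { lift s := {
      obj := fun a i => (s.π.app ⟨i⟩).obj a
      edge := fun a b => Pi.lift fun i => (s.π.app ⟨i⟩).edge a b }
    fac := fac
    uniq s _ hm := productCone_hom_ext fun i => (hm i).trans (fac s i).symm }

end

/-! ### Cartesian maps -/

section

variable {P : Type w} (Y : VGraph.{w} V) (g : P → Y.Obj)

/-- The inverse image of a `V`-graph under a function into its set of objects. -/
def pullback : VGraph.{w} V where
  Obj := P
  Edge a b := Y.Edge (g a) (g b)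

/-- The cartesian map from the inverse image. -/
def pullbackMap : pullback Y g ⟶ Y where
  obj := g
  edge _ _ := 𝟙 _

variable {Y g}

/-- The lift of a map to the inverse image. -/
def pullbackLift {X : VGraph.{w} V} (m : X ⟶ Y) (t : X.Obj → P) (h : ∀ x, m.obj x = g (t x)) :
    X ⟶ pullback Y g where
  obj := t
  edge a b := m.edge a b ≫ eqToHom (edge_eq (h a) (h b))

@[simp]
theorem pullbackLift_map {X : VGraph.{w} V} (m : X ⟶ Y) (t : X.Obj → P)
    (h : ∀ x, m.obj x = g (t x)) : pullbackLift m t h ≫ pullbackMap Y g = m :=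
  hom_ext (fun x => (h x).symm) fun _ _ =>
    (congrArg (· ≫ _) (Category.comp_id _)).trans (comp_eqToHom_cancel _ _ _)

theorem pullback_hom_ext {X : VGraph.{w} V} {m m' : X ⟶ pullback Y g}
    (h : ∀ x, m.obj x = m'.obj x) (h' : m ≫ pullbackMap Y g = m' ≫ pullbackMap Y g) : m = m' := by
  obtain ⟨fo, fe⟩ := m
  obtain ⟨go, ge⟩ := m'
  obtain rfl : fo = go := funext h
  congr
  funext a b
  have e := congr_edge h' a b
  exact (Category.comp_id _).symm.trans ((Category.comp_id _).symm.trans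
    (e.trans (Category.comp_id _)))

end

/-! ### Fibres over a set -/

variable (V) in
/-- The fibre of `V`-graphs over a set `P`: graphs whose set of objects is identified with `P`. -/
structure Fiber (P : Type w) : Type (max u (w + 1)) where
  graph : VGraph.{w} V
  fn : P → graph.Obj
  bij : Function.Bijective fn

namespace Fiber

variable {P : Type w}

@[ext]
structure Hom (X Y : Fiber V P) where
  map : X.graph ⟶ Y.graph
  map_fn : ∀ p, map.obj (X.fn p) = Y.fn p

instance : Category (Fiber V P) where
  Hom := Hom
  id X := ⟨𝟙 _, fun _ => rfl⟩
  comp f g := ⟨f.map ≫ g.map, fun p => by rw [comp_obj, f.map_fn, g.map_fn]⟩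

theorem hom_ext {X Y : Fiber V P} {f g : X ⟶ Y} (h : f.map = g.map) : f = g := Hom.ext h

variable (V P) in
/-- The underlying graph. -/
def forget : Fiber V P ⥤ VGraph.{w} V where
  obj X := X.graph
  map f := f.map

variable (V P) in
/-- A graph on the set `P` is a family of objects of `V`. -/
def ofEdges : (Discrete (P × P) ⥤ V) ⥤ Fiber V P where
  obj E := ⟨⟨P, fun a b => E.obj ⟨(a, b)⟩⟩, id, Function.bijective_id⟩
  map f := ⟨⟨id, fun a b => f.app ⟨(a, b)⟩⟩, fun _ => rfl⟩

instance : (ofEdges V P).Faithful where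
  map_injective {E E'} f g h := by
    ext ⟨a, b⟩
    have := congr_edge (congrArg Hom.map h) a b
    exact (Category.comp_id _).symm.trans this

instance : (ofEdges V P).Full where
  map_surjective {E E'} f := by
    have hf (p : P) : f.map.obj p = p := f.map_fn p
    refine ⟨Discrete.natTrans fun x => f.map.edge x.as.1 x.as.2 ≫
      eqToHom (edge_eq (hf _) (hf _)), ?_⟩
    refine hom_ext (VGraph.hom_ext (fun p => (hf p).symm) fun a b => ?_)
    exact comp_eqToHom_cancel _ _ _

instance : (ofEdges V P).EssSurj where
  mem_essImage X := by
    let e := Equiv.ofBijective _ X.bij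
    let i : (ofEdges V P).obj (Discrete.functor fun x => X.graph.Edge (X.fn x.1) (X.fn x.2)) ⟶ X :=
      ⟨pullbackMap X.graph X.fn, fun _ => rfl⟩
    have h (x : X.graph.Obj) : Hom.obj (𝟙 X.graph) x = X.fn (e.symm x) :=
      (e.apply_symm_apply x).symm
    let j : X ⟶ (ofEdges V P).obj
        (Discrete.functor fun x => X.graph.Edge (X.fn x.1) (X.fn x.2)) :=
      ⟨pullbackLift (g := X.fn) (𝟙 _) e.symm h, e.symm_apply_apply⟩
    have hj : j ≫ i = 𝟙 X := hom_ext (pullbackLift_map _ _ h)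
    refine ⟨_, ⟨⟨i, j, hom_ext (pullback_hom_ext (Y := X.graph) (g := X.fn) e.symm_apply_apply ?_),
      hj⟩⟩⟩
    have h' : (i ≫ j) ≫ i = 𝟙 _ ≫ i := by
      rw [Category.assoc, hj, Category.comp_id, Category.id_comp]
    exact congrArg Hom.map h'

instance : (ofEdges V P).IsEquivalence where

instance [HasColimitsOfSize.{w, w} V] : HasColimitsOfSize.{w, w} (Fiber V P) :=
  Adjunction.has_colimits_of_equivalence (ofEdges V P).inv

end Fiber

end VGraph

/-! ### Colimits and monads in the fibres -/

namespace VGraph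

variable {V : Type u} [Category.{v} V]

theorem comp_eqToHom_eq {A B C D E : V} {x : A ⟶ B} {y : B ⟶ C} {z : A ⟶ D} {h : C = D}
    (e : (x ≫ y) ≫ eqToHom h = z) (h' : D = E) (h'' : C = E) :
    x ≫ y ≫ eqToHom h'' = z ≫ eqToHom h' := by
  subst h h'
  simpa using e

namespace Fiber

variable {P : Type w}

section

variable {J : Type*} [Category J]

/-- The transition maps are identities on objects, so over a connected shape all legs of a cocone
have the same object function. The cocone is then a family of cocones in `V`, one for each pair in
`P`. -/
theorem preservesColimitsOfShape_ofEdges_forget [IsConnected J] [HasColimitsOfShape J V] :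
    PreservesColimitsOfShape J (ofEdges V P ⋙ forget V P) where
  preservesColimit {K} := ⟨fun {c} hc => ⟨by
    let j₀ : J := Classical.arbitrary J
    have hs (s : Cocone (K ⋙ ofEdges V P ⋙ forget V P)) (p : P) (j : J) :
        (s.ι.app j).obj p = (s.ι.app j₀).obj p := by
      let F (j : J) : s.pt.Obj := (s.ι.app j).obj p
      have hF (i j : J) (f : i ⟶ j) : F i = F j :=
        (congrFun (congrArg VGraph.Hom.obj (s.w f)) p).symm
      exact constant_of_preserves_morphisms F hF j j₀
    let hcE (a b : P) := isColimitOfPreserves ((evaluation (Discrete (P × P)) V).obj ⟨(a, b)⟩) hc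
    let d (s : Cocone (K ⋙ ofEdges V P ⋙ forget V P)) (a b : P) :
        Cocone (K ⋙ (evaluation (Discrete (P × P)) V).obj ⟨(a, b)⟩) := {
      pt := s.pt.Edge ((s.ι.app j₀).obj a) ((s.ι.app j₀).obj b)
      ι := {
        app j := (s.ι.app j).edge a b ≫ eqToHom (edge_eq (hs s a j) (hs s b j))
        naturality i j f := by
          exact (comp_eqToHom_eq (congr_edge (s.w f) a b) (edge_eq (hs s a i) (hs s b i))
            (edge_eq (hs s a j) (hs s b j))).trans (Category.comp_id _).symm } }
    have fac (s : Cocone (K ⋙ ofEdges V P ⋙ forget V P)) (j : J) :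
        (ofEdges V P ⋙ forget V P).map (c.ι.app j) ≫
        VGraph.Hom.mk (X := (ofEdges V P ⋙ forget V P).obj c.pt) (Y := s.pt)
          (s.ι.app j₀).obj (fun a b => (hcE a b).desc (d s a b)) =
          s.ι.app j := by
      refine VGraph.hom_ext (fun p => (hs s p j).symm) fun a b => ?_
      refine (congrArg (· ≫ _) ((hcE a b).fac (d s a b) j)).trans ?_
      exact comp_eqToHom_cancel _ _ _
    refine {
      desc s := ⟨(s.ι.app j₀).obj, fun a b => (hcE a b).desc (d s a b)⟩
      fac := fac
      uniq s m hm := ?_ }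
    refine VGraph.hom_ext (fun p => congrFun (congrArg VGraph.Hom.obj (hm j₀)) p) fun a b => ?_
    refine (hcE a b).hom_ext fun j => ?_
    refine Eq.trans ?_ ((hcE a b).fac (d s a b) j).symm
    exact comp_eqToHom_eq (congr_edge (hm j) a b) (edge_eq (hs s a j) (hs s b j)) _⟩⟩

theorem preservesColimitsOfShape_forget [IsConnected J] [HasColimitsOfShape J V] :
    PreservesColimitsOfShape J (forget V P) :=
  have := preservesColimitsOfShape_ofEdges_forget (V := V) (P := P) (J := J)
  preservesColimitsOfShape_of_natIso (F := (ofEdges V P).inv ⋙ ofEdges V P ⋙ forget V P)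
    (Functor.isoWhiskerRight (ofEdges V P).asEquivalence.counitIso (forget V P) ≪≫
      (forget V P).leftUnitor)

/-- The shape is nonempty so that some leg forces the induced map to respect the identifications
with `P`. -/
theorem reflectsColimitsOfShape_forget [Nonempty J] :
    ReflectsColimitsOfShape J (forget V P) where
  reflectsColimit {K} := ⟨fun {c} hc => ⟨{
    desc s := ⟨hc.desc ((forget V P).mapCocone s), fun p => by
      let j₀ : J := Classical.arbitrary J
      refine Eq.trans (congrArg _ ((c.ι.app j₀).map_fn p).symm) (Eq.trans ?_
        ((s.ι.app j₀).map_fn p))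
      exact congrFun (congrArg VGraph.Hom.obj (hc.fac ((forget V P).mapCocone s) j₀)) _⟩
    fac s j := hom_ext (hc.fac ((forget V P).mapCocone s) j)
    uniq s m hm := hom_ext (hc.uniq ((forget V P).mapCocone s) m.map
      fun j => congrArg Hom.map (hm j)) }⟩⟩

end

/-! ### The monad on a fibre -/

section

variable (T : Monad (VGraph.{w} V)) (hη : ∀ X, Function.Bijective (T.η.app X).obj) (P)

theorem _root_.VGraph.map_obj_unit {X Y : VGraph.{w} V} (f : X ⟶ Y) (x : X.Obj) :
    (T.map f).obj ((T.η.app X).obj x) = (T.η.app Y).obj (f.obj x) :=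
  (congrFun (congrArg VGraph.Hom.obj (Monad.unit_naturality _ T f)) x).symm

theorem _root_.VGraph.mult_obj_unit (X : VGraph.{w} V) (x : (T.obj X).Obj) :
    (T.μ.app X).obj ((T.η.app (T.obj X)).obj x) = x :=
  congrFun (congrArg VGraph.Hom.obj (T.left_unit X)) x

/-- The restriction to a fibre of a monad whose unit is bijective on objects. -/
def monad : Monad (Fiber V P) where
  obj X := ⟨T.obj X.graph, (T.η.app X.graph).obj ∘ X.fn, (hη _).comp X.bij⟩
  map f := ⟨T.map f.map, fun p =>
    (map_obj_unit T f.map _).trans (congrArg _ (f.map_fn p))⟩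
  map_id _ := hom_ext (T.map_id _)
  map_comp _ _ := hom_ext (T.map_comp _ _)
  η := {
    app X := ⟨T.η.app X.graph, fun _ => rfl⟩
    naturality _ _ f := hom_ext (T.η.naturality f.map) }
  μ := {
    app X := ⟨T.μ.app X.graph, fun _ => mult_obj_unit T _ _⟩
    naturality _ _ f := hom_ext (T.μ.naturality f.map) }
  assoc X := hom_ext (T.assoc X.graph)
  left_unit X := hom_ext (T.left_unit X.graph)
  right_unit X := hom_ext (T.right_unit X.graph)

/-- `κ`-filtered shapes are connected, so `forget` preserves and reflects their colimits and
preservation by `T` passes to the fibre. -/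
theorem isAccessible_monad [HasColimitsOfSize.{w, w} V] [T.toFunctor.IsAccessible.{w}] :
    (monad P T hη).toFunctor.IsAccessible.{w} := by
  obtain ⟨κ, _, _⟩ := Functor.IsAccessible.exists_cardinal (F := T.toFunctor)
  refine ⟨κ, inferInstance, ⟨fun J _ _ => ?_⟩⟩
  have := isFiltered_of_isCardinalFiltered J κ
  have := IsFiltered.isConnected J
  have := T.toFunctor.preservesColimitsOfShape_of_isCardinalAccessible κ J
  have := preservesColimitsOfShape_forget (V := V) (P := P) (J := J)
  have := reflectsColimitsOfShape_forget (V := V) (P := P) (J := J)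
  have : PreservesColimitsOfShape J ((monad P T hη).toFunctor ⋙ forget V P) :=
    inferInstanceAs (PreservesColimitsOfShape J (forget V P ⋙ T.toFunctor))
  exact preservesColimitsOfShape_of_reflects_of_preserves _ (forget V P)

end

/-! ### Sums of direct images -/

/-- The sum in the fibre over `P` of the direct images of a family of graphs under functions of
their sets of objects into `P`. -/
theorem exists_sum_directImage [HasColimitsOfSize.{w, w} V] {S : Type w} (Y : S → VGraph.{w} V)
    (i : ∀ s, (Y s).Obj → P) :
    ∃ (W : Fiber V P) (inn : ∀ s, Y s ⟶ W.graph), (∀ s y, (inn s).obj y = W.fn (i s y)) ∧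
      (∀ (Z : Fiber V P) (h : ∀ s, Y s ⟶ Z.graph), (∀ s y, (h s).obj y = Z.fn (i s y)) →
        ∃ k : W ⟶ Z, ∀ s, inn s ≫ k.map = h s) ∧
      ∀ (Z : Fiber V P) (k k' : W ⟶ Z), (∀ s, inn s ≫ k.map = inn s ≫ k'.map) → k = k' := by
  have : HasCoproducts.{w} V := inferInstance
  -- The edges from `p` to `q` are the coproduct of all edges in the family whose endpoints are sent
  -- to `p` and `q`.
  let I (p q : P) := { x : Σ s, (Y s).Obj × (Y s).Obj // i x.1 x.2.1 = p ∧ i x.1 x.2.2 = q }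
  let F (p q : P) (x : I p q) : V := (Y x.1.1).Edge x.1.2.1 x.1.2.2
  let W : Fiber V P := ⟨⟨P, fun p q => ∐ F p q⟩, id, Function.bijective_id⟩
  let inn (s) : Y s ⟶ W.graph := ⟨i s, fun a b => Sigma.ι (F (i s a) (i s b)) ⟨⟨s, a, b⟩, rfl, rfl⟩⟩
  refine ⟨W, inn, fun _ _ => rfl, fun Z h hZ => ?_, fun Z k k' hk => ?_⟩
  · refine ⟨⟨⟨Z.fn, fun p q => Sigma.desc fun x => (h x.1.1).edge x.1.2.1 x.1.2.2 ≫
      eqToHom (edge_eq ((hZ _ _).trans (congrArg Z.fn x.2.1))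
        ((hZ _ _).trans (congrArg Z.fn x.2.2)))⟩, fun _ => rfl⟩, fun s => ?_⟩
    refine VGraph.hom_ext (fun a => (hZ s a).symm) fun a b => ?_
    refine (congrArg (· ≫ _) (Sigma.ι_desc _ _)).trans ?_
    exact comp_eqToHom_cancel _ _ _
  · obtain ⟨⟨ko, ke⟩, hko⟩ := k
    obtain ⟨⟨ko', ke'⟩, hko'⟩ := k'
    obtain rfl : ko = ko' := funext fun p => (hko p).trans (hko' p).symm
    congr
    funext p q
    refine Sigma.hom_ext _ _ ?_
    rintro ⟨⟨s, a, b⟩, rfl, rfl⟩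
    exact (Category.comp_id _).symm.trans (congr_edge (hk s) a b)

end Fiber

end VGraph

/-! ### Strong universality from bijectivity on elements -/

namespace Multimap

section

variable {A : Type u} [Category.{v} A] {U : A ⥤ Type w} {ι : Type} [DecidableEq ι]
  {X : ι → A} {b c : A}

theorem IsUniversal.postcomp_iso {f : Multimap U X b} (hf : f.IsUniversal) {b' : A} (e : b ≅ b') :
    (f.postcomp e.hom).IsUniversal := by
  intro c
  have h : (fun h : b' ⟶ c => (f.postcomp e.hom).postcomp h) =
      (fun h : b ⟶ c => f.postcomp h) ∘ fun h : b' ⟶ c => e.hom ≫ h := by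
    funext h
    refine Multimap.ext ?_ ?_
    · funext x
      exact (ConcreteCategory.congr_hom (U.map_comp _ _) _).symm
    · funext i z
      exact Category.assoc _ _ _
  rw [h]
  refine (hf c).comp ⟨fun _ _ => (cancel_epi e.hom).1, fun h => ⟨e.inv ≫ h, ?_⟩⟩
  exact e.hom_inv_id_assoc h

variable {m : ℕ} {C : Fin m → A}

/-- A pair of families is a family indexed by the sum. -/
def pair (x : ∀ k, U.obj (C k)) (y : ∀ i, U.obj (X i)) :
    ∀ s, U.obj (Sum.elim C X s) := fun s => match s with
  | Sum.inl k => x k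
  | Sum.inr i => y i

/-- Replace the last element of an incomplete family by a family. -/
def substLast {l : Fin m}
    (z : ∀ k : {k : Fin m ⊕ Unit // k ≠ Sum.inl l}, U.obj (Sum.elim C (fun _ => b) k.1))
    (y : ∀ i, U.obj (X i)) (k : {k : Fin m ⊕ ι // k ≠ Sum.inl l}) :
    U.obj (Sum.elim C X k.1) := match k with
  | ⟨Sum.inl l', h⟩ => z ⟨Sum.inl l', fun e => h (congrArg Sum.inl (Sum.inl.inj e))⟩
  | ⟨Sum.inr i, _⟩ => y i

/-- Extend an incomplete family, whose last element is lacking, by an incomplete family. -/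
def extendLast {i : ι}
    (z : ∀ k : {k : Fin m ⊕ Unit // k ≠ Sum.inr ()}, U.obj (Sum.elim C (fun _ => b) k.1))
    (w : ∀ k : {k // k ≠ i}, U.obj (X k)) (k : {k : Fin m ⊕ ι // k ≠ Sum.inr i}) :
    U.obj (Sum.elim C X k.1) := match k with
  | ⟨Sum.inl l, _⟩ => z ⟨Sum.inl l, Sum.inl_ne_inr⟩
  | ⟨Sum.inr i', h⟩ => w ⟨i', fun e => h (congrArg Sum.inr e)⟩

/-- The multimap in the last variables obtained by fixing the first variables. -/
def slice (h : Multimap U (Sum.elim C X) c)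
    (z : ∀ k : {k : Fin m ⊕ Unit // k ≠ Sum.inr ()}, U.obj (Sum.elim C (fun _ => b) k.1)) :
    Multimap U X c where
  fn y := h.fn (pair (fun k => z ⟨Sum.inl k, Sum.inl_ne_inr⟩) y)
  lin i w := h.lin (Sum.inr i) (extendLast z w)
  map_lin i w a := by
    refine (h.map_lin (Sum.inr i) _ a).trans (congrArg h.fn (funext fun s => ?_))
    match s with
    | Sum.inl l =>
      exact insertAt_ne (F := fun s => U.obj (Sum.elim C X s)) (Sum.inr i) _ a _ Sum.inl_ne_inr
    | Sum.inr k =>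
      by_cases hk : k = i
      · subst hk
        exact (insertAt_self (F := fun s => U.obj (Sum.elim C X s)) (Sum.inr k) _ a).trans
          (insertAt_self (F := fun s => U.obj (X s)) _ _ a).symm
      · exact (insertAt_ne (F := fun s => U.obj (Sum.elim C X s)) (Sum.inr i) _ a _
          fun e => hk (Sum.inr.inj e)).trans
          (insertAt_ne (F := fun s => U.obj (X s)) _ _ a _ hk).symm

theorem placed_fn_pair (g : Multimap U (Sum.elim C fun _ : Unit => b) c) (f : Multimap U X b)
    (x : ∀ k, U.obj (C k)) (y : ∀ i, U.obj (X i)) :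
    (g.placed f).fn (pair x y) = g.fn (pair x fun _ => f.fn y) :=
  congrArg g.fn (funext fun s => match s with
    | Sum.inl _ => rfl
    | Sum.inr _ => rfl)

theorem placed_lin_substLast (g : Multimap U (Sum.elim C fun _ : Unit => b) c)
    (f : Multimap U X b) {l : Fin m}
    (z : ∀ k : {k : Fin m ⊕ Unit // k ≠ Sum.inl l}, U.obj (Sum.elim C (fun _ => b) k.1))
    (y : ∀ i, U.obj (X i)) (h : f.fn y = z ⟨Sum.inr (), Sum.inr_ne_inl⟩) :
    (g.placed f).lin (Sum.inl l) (substLast z y) = g.lin (Sum.inl l) z :=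
  congrArg (g.lin (Sum.inl l)) (funext fun s => match s with
    | ⟨Sum.inl _, _⟩ => rfl
    | ⟨Sum.inr _, _⟩ => h)

/-- This reduces the linear parts of `g` in its last variable to the universal property of `f`. -/
theorem slice_placed (g : Multimap U (Sum.elim C fun _ : Unit => b) c)
    (f : Multimap U X b)
    (z : ∀ k : {k : Fin m ⊕ Unit // k ≠ Sum.inr ()}, U.obj (Sum.elim C (fun _ => b) k.1)) :
    (g.placed f).slice z = f.postcomp (g.lin (Sum.inr ()) z) := by
  refine Multimap.ext (funext fun y => ?_) (funext fun i => funext fun w => ?_)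
  · refine (placed_fn_pair _ _ _ _).trans
      (Eq.trans (congrArg g.fn (funext fun s => ?_)) (g.map_lin (Sum.inr ()) z (f.fn y)).symm)
    match s with
    | Sum.inl l =>
      exact (insertAt_ne (F := fun s => U.obj (Sum.elim C (fun _ => b) s)) (Sum.inr ()) _ (f.fn y) _
        Sum.inl_ne_inr).symm
    | Sum.inr () =>
      exact (insertAt_self (F := fun s => U.obj (Sum.elim C (fun _ => b) s)) (Sum.inr ()) _
        (f.fn y)).symm
  · refine congrArg (f.lin i w ≫ ·) (congrArg (g.lin (Sum.inr ())) (funext fun s => ?_))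
    match s with
    | ⟨Sum.inl _, _⟩ => rfl
    | ⟨Sum.inr (), h⟩ => exact absurd rfl h

/-- A universal multimap which is bijective on elements is strongly universal. -/
theorem IsUniversal.isStronglyUniversal {f : Multimap U X b} (hf : f.IsUniversal)
    (hb : Function.Bijective f.fn) : f.IsStronglyUniversal := by
  refine ⟨hf, fun m C c => ⟨fun g g' h => ?_, fun h => ?_⟩⟩
  · dsimp only at h
    refine Multimap.ext (funext fun x => ?_) (funext fun s => funext fun z => ?_)
    · obtain ⟨y, hy⟩ := hb.2 (x (Sum.inr ()))
      have hx : x = pair (fun k => x (Sum.inl k)) (fun _ => f.fn y) :=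
        funext fun s => match s with
          | Sum.inl _ => rfl
          | Sum.inr () => hy.symm
      rw [hx]
      have e := congrFun (congrArg Multimap.fn h) (pair (fun k => x (Sum.inl k)) y)
      exact (placed_fn_pair g f _ y).symm.trans (e.trans (placed_fn_pair g' f _ y))
    · match s with
      | Sum.inl l =>
        obtain ⟨y, hy⟩ := hb.2 (z ⟨Sum.inr (), Sum.inr_ne_inl⟩)
        rw [← placed_lin_substLast g f z y hy, ← placed_lin_substLast g' f z y hy, h]
      | Sum.inr () =>
        refine (hf c).1 ?_
        dsimp only
        rw [← slice_placed, ← slice_placed, h]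
  · let e := Equiv.ofBijective _ hb
    -- The linear part in the last variable comes from universality, applied to each slice of `h`;
    -- in the other variables `h` is evaluated at the tuple corresponding to the given element of
    -- `b`.
    let d (z : ∀ k : {k : Fin m ⊕ Unit // k ≠ Sum.inr ()}, U.obj (Sum.elim C (fun _ => b) k.1)) :
        b ⟶ c := (Equiv.ofBijective _ (hf c)).symm (h.slice z)
    have hd (z) : f.postcomp (d z) = h.slice z :=
      (Equiv.ofBijective _ (hf c)).apply_symm_apply (h.slice z)
    let g : Multimap U (Sum.elim C fun _ : Unit => b) c := {
      fn := fun x => h.fn (pair (fun k => x (Sum.inl k)) (e.symm (x (Sum.inr ()))))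
      lin := fun s => match s with
        | Sum.inl l => fun z =>
          h.lin (Sum.inl l) (substLast z (e.symm (z ⟨Sum.inr (), Sum.inr_ne_inl⟩)))
        | Sum.inr () => fun z => d z
      map_lin := fun s z a => by
        match s with
        | Sum.inl l =>
          refine (h.map_lin (Sum.inl l) _ a).trans (congrArg h.fn (funext fun s => ?_))
          match s with
          | Sum.inl k =>
            by_cases hk : k = l
            · subst hk
              exact (insertAt_self (F := fun s => U.obj (Sum.elim C X s)) (Sum.inl k) _ a).trans
                (insertAt_self (F := fun s => U.obj (Sum.elim C (fun _ => b) s))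
                  (Sum.inl k) _ a).symm
            · have hk' {β : Type} : (Sum.inl k : Fin m ⊕ β) ≠ Sum.inl l :=
                fun e => hk (Sum.inl.inj e)
              exact (insertAt_ne (F := fun s => U.obj (Sum.elim C X s)) (Sum.inl l) _ a _ hk').trans
                (insertAt_ne (F := fun s => U.obj (Sum.elim C (fun _ => b) s)) (Sum.inl l) _ a _
                  hk').symm
          | Sum.inr i =>
            refine (insertAt_ne (F := fun s => U.obj (Sum.elim C X s)) (Sum.inl l) _ a _
              Sum.inr_ne_inl).trans (congrFun (congrArg e.symm ?_) i)
            exact (insertAt_ne (F := fun s => U.obj (Sum.elim C (fun _ => b) s)) (Sum.inl l) _ a _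
              Sum.inr_ne_inl).symm
        | Sum.inr () =>
          obtain ⟨y, rfl⟩ := hb.2 a
          refine (congrFun (congrArg Multimap.fn (hd z)) y).trans
            (congrArg h.fn (funext fun s => ?_))
          match s with
          | Sum.inl k =>
            exact (insertAt_ne (F := fun s => U.obj (Sum.elim C (fun _ => b) s)) (Sum.inr ()) _
              (f.fn y) _ Sum.inl_ne_inr).symm
          | Sum.inr i =>
            refine congrFun (Eq.trans (e.symm_apply_apply y).symm (congrArg e.symm ?_)) i
            exact (insertAt_self (F := fun s => U.obj (Sum.elim C (fun _ => b) s)) (Sum.inr ()) _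
              (f.fn y)).symm }
    refine ⟨g, Multimap.ext (funext fun x => ?_) (funext fun s => funext fun z => ?_)⟩
    · refine congrArg h.fn (funext fun s => ?_)
      match s with
      | Sum.inl _ => rfl
      | Sum.inr i => exact congrFun (e.symm_apply_apply fun i => x (Sum.inr i)) i
    · match s with
      | Sum.inl l =>
        refine congrArg (h.lin (Sum.inl l)) (funext fun s => ?_)
        match s with
        | ⟨Sum.inl _, _⟩ => rfl
        | ⟨Sum.inr i, _⟩ =>
          exact congrFun (e.symm_apply_apply fun i => z ⟨Sum.inr i, Sum.inr_ne_inl⟩) i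
      | Sum.inr i =>
        refine (congrFun (congrFun (congrArg Multimap.lin (hd _)) i) _).trans
          (congrArg (h.lin (Sum.inr i)) (funext fun s => ?_))
        match s with
        | ⟨Sum.inl _, _⟩ => rfl
        | ⟨Sum.inr _, _⟩ => rfl

end

end Multimap

/-! ### Construction of universal multimaps of algebras -/

namespace VGraph

variable {V : Type u} [Category.{v} V] {T : Monad (VGraph.{w} V)}

theorem congr_obj {X Y : VGraph.{w} V} {f g : X ⟶ Y} (h : f = g) (x : X.Obj) :
    f.obj x = g.obj x := by rw [h]

theorem algebra_obj_unit (c : T.Algebra) (x : c.A.Obj) :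
    c.a.obj ((T.η.app c.A).obj x) = x :=
  congr_obj c.unit x

variable (hη : ∀ X, Function.Bijective (T.η.app X).obj)

include hη in
theorem exists_unit_eq {X : VGraph.{w} V} (y : (T.obj X).Obj) :
    ∃ x : X.Obj, (T.η.app X).obj x = y :=
  (hη X).2 y

/-- The inverse of the unit on objects. -/
noncomputable def unitInv (X : VGraph.{w} V) : (T.obj X).Obj → X.Obj :=
  (Equiv.ofBijective _ (hη X)).symm

theorem unitInv_unit {X : VGraph.{w} V} (x : X.Obj) :
    unitInv hη X ((T.η.app X).obj x) = x :=
  (Equiv.ofBijective _ (hη X)).symm_apply_apply x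

/-! ### Inverse images of algebras -/

section

variable {P : Type w} (c : T.Algebra) (g : P → c.A.Obj)

theorem map_pullbackMap_obj (y : (T.obj (pullback c.A g)).Obj) :
    (T.map (pullbackMap c.A g) ≫ c.a).obj y = g (unitInv hη (pullback c.A g) y) := by
  obtain ⟨p, rfl⟩ := exists_unit_eq hη y
  rw [unitInv_unit, comp_obj, map_obj_unit, algebra_obj_unit]
  rfl

/-- The structure map of the inverse image of an algebra. -/
noncomputable def pullbackStr : T.obj (pullback c.A g) ⟶ pullback c.A g :=
  pullbackLift (T.map (pullbackMap c.A g) ≫ c.a) (unitInv hη (pullback c.A g))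
    (map_pullbackMap_obj hη c g)

theorem pullbackStr_obj_unit (p : P) :
    (pullbackStr hη c g).obj ((T.η.app (pullback c.A g)).obj p) = p :=
  unitInv_unit hη (X := pullback c.A g) p

theorem pullbackStr_map :
    pullbackStr hη c g ≫ pullbackMap c.A g = T.map (pullbackMap c.A g) ≫ c.a :=
  pullbackLift_map _ _ (map_pullbackMap_obj hη c g)

/-- The inverse image of an algebra under a function into its set of objects. -/
noncomputable def pullbackAlgebra : T.Algebra where
  A := pullback c.A g
  a := pullbackStr hη c g
  unit := pullback_hom_ext (pullbackStr_obj_unit hη c g) (by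
    rw [Category.assoc, pullbackStr_map]
    refine (Monad.unit_naturality_assoc _ T (pullbackMap c.A g) c.a).symm.trans ?_
    rw [c.unit, Category.comp_id]
    exact (Category.id_comp _).symm)
  assoc := pullback_hom_ext (fun y => by
      obtain ⟨x, rfl⟩ := exists_unit_eq hη y
      rw [comp_obj, comp_obj, mult_obj_unit, map_obj_unit]
      exact (pullbackStr_obj_unit hη c g _).symm) (by
    rw [Category.assoc, pullbackStr_map, Category.assoc, pullbackStr_map,
      ← T.map_comp_assoc, pullbackStr_map, T.map_comp, Category.assoc, ← c.assoc]
    exact (Monad.mu_naturality_assoc _ T _ _).symm)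

/-- The cartesian map from the inverse image. -/
noncomputable def pullbackAlgebraMap : pullbackAlgebra hη c g ⟶ c where
  f := pullbackMap c.A g
  h := (pullbackStr_map hη c g).symm

variable {c g}

/-- The lift of an algebra map to the inverse image. -/
noncomputable def pullbackAlgebraLift {X : T.Algebra} (m : X ⟶ c) (t : X.A.Obj → P)
    (h : ∀ x, m.f.obj x = g (t x)) : X ⟶ pullbackAlgebra hη c g where
  f := pullbackLift m.f t h
  h := by
    refine pullback_hom_ext (Y := c.A) (g := g) (fun y => ?_) ?_
    · obtain ⟨x, rfl⟩ := exists_unit_eq hη y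
      refine (congrArg (pullbackStr hη c g).obj (map_obj_unit T _ _)).trans ?_
      refine (pullbackStr_obj_unit hη c g _).trans (congrArg t ?_)
      exact (algebra_obj_unit X x).symm
    · let L : X.A ⟶ pullback c.A g := pullbackLift m.f t h
      have hL : L ≫ pullbackMap c.A g = m.f := pullbackLift_map _ _ h
      have e : T.map L ≫ T.map (pullbackMap c.A g) ≫ c.a = X.a ≫ L ≫ pullbackMap c.A g := by
        rw [← T.map_comp_assoc, hL, m.h]
      exact ((Category.assoc _ _ _).trans
        (congrArg (T.map L ≫ ·) (pullbackStr_map hη c g))).trans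
          (e.trans (Category.assoc _ _ _).symm)

theorem pullbackAlgebraLift_map {X : T.Algebra} (m : X ⟶ c) (t : X.A.Obj → P)
    (h : ∀ x, m.f.obj x = g (t x)) :
    pullbackAlgebraLift hη m t h ≫ pullbackAlgebraMap hη c g = m :=
  Monad.Algebra.Hom.ext (pullbackLift_map _ _ h)

end

/-! ### Algebras in a fibre -/

namespace Fiber

variable {P : Type w}

/-- An algebra whose set of objects is identified with `P`, as an algebra in the fibre. -/
def algebra (c : T.Algebra) (fn : P → c.A.Obj) (bij : Function.Bijective fn) :
    (monad P T hη).Algebra where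
  A := ⟨c.A, fn, bij⟩
  a := ⟨c.a, fun p => algebra_obj_unit c (fn p)⟩
  unit := hom_ext c.unit
  assoc := hom_ext c.assoc

variable {hη}

/-- The algebra underlying an algebra in a fibre. -/
def toAlgebra (Z : (monad P T hη).Algebra) : T.Algebra where
  A := Z.A.graph
  a := Z.a.map
  unit := congrArg Hom.map Z.unit
  assoc := congrArg Hom.map Z.assoc

end Fiber

/-! ### Universal multimaps -/

include hη in
theorem exists_isUniversal_bijective [HasColimitsOfSize.{w, w} V] [T.toFunctor.IsAccessible.{w}]
    {ι : Type} [DecidableEq ι] (X : ι → T.Algebra) :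
    ∃ (Z : T.Algebra) (f : Multimap (algObjects T) X Z),
      f.IsUniversal ∧ Function.Bijective f.fn := by
  let P := ∀ i, (X i).A.Obj
  let S := Σ j, ∀ k : {k // k ≠ j}, (X k.1).A.Obj
  let i (s : S) (a : (X s.1).A.Obj) : P := insertAt (F := fun k => (X k).A.Obj) s.1 s.2 a
  obtain ⟨W, inn, inn_obj, hW, hW'⟩ := Fiber.exists_sum_directImage (fun s : S => (X s.1).A) i
  -- `W₁` carries the equations to be imposed: `u` and `v` are the two sides of the condition that
  -- the map from each summand of `W` be an algebra morphism, as `key` verifies.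
  obtain ⟨W₁, inn₁, -, hW₁, hW₁'⟩ := Fiber.exists_sum_directImage
    (fun s : S => T.obj (X s.1).A) fun s y => i s ((X s.1).a.obj y)
  let TP := Fiber.monad P T hη
  obtain ⟨u, hu⟩ := hW₁ (TP.obj W) (fun s => T.map (inn s)) fun s y => by
    obtain ⟨x, rfl⟩ := exists_unit_eq hη y
    rw [map_obj_unit, algebra_obj_unit, inn_obj]
    rfl
  obtain ⟨v, hv⟩ := hW₁ (TP.obj W) (fun s => (X s.1).a ≫ inn s ≫ T.η.app W.graph) fun s y => by
    exact congrArg (T.η.app W.graph).obj (inn_obj s _)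
  have key (Y : TP.Algebra) (k : W ⟶ Y.A) : u ≫ TP.map k ≫ Y.a = v ≫ TP.map k ≫ Y.a ↔
      ∀ s, T.map (inn s ≫ k.map) ≫ Y.a.map = (X s.1).a ≫ inn s ≫ k.map := by
    let u₀ : W₁.graph ⟶ T.obj W.graph := u.map
    let v₀ : W₁.graph ⟶ T.obj W.graph := v.map
    let y : T.obj Y.A.graph ⟶ Y.A.graph := Y.a.map
    have hu₀ (s) : inn₁ s ≫ u₀ = T.map (inn s) := hu s
    have hv₀ (s) : inn₁ s ≫ v₀ = (X s.1).a ≫ inn s ≫ T.η.app W.graph := hv s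
    have hy : T.η.app Y.A.graph ≫ y = 𝟙 _ := congrArg Fiber.Hom.map Y.unit
    have hk : T.η.app W.graph ≫ T.map k.map ≫ y = k.map := by
      refine (Monad.unit_naturality_assoc _ T k.map y).symm.trans ?_
      rw [hy]
      exact Category.comp_id _
    have h₁ (s) : inn₁ s ≫ (u ≫ TP.map k ≫ Y.a).map = T.map (inn s ≫ k.map) ≫ Y.a.map := by
      change inn₁ s ≫ u₀ ≫ T.map k.map ≫ y = T.map (inn s ≫ k.map) ≫ y
      rw [← Category.assoc, hu₀, T.map_comp, Category.assoc]
    have h₂ (s) : inn₁ s ≫ (v ≫ TP.map k ≫ Y.a).map = (X s.1).a ≫ inn s ≫ k.map := by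
      change inn₁ s ≫ v₀ ≫ T.map k.map ≫ y = _
      rw [← Category.assoc, hv₀]
      refine (Category.assoc _ _ _).trans (congrArg ((X s.1).a ≫ ·) ?_)
      exact (Category.assoc _ _ _).trans (congrArg (inn s ≫ ·) hk)
    constructor
    · intro h s
      rw [← h₁, ← h₂, h]
    · intro h
      refine hW₁' _ _ _ fun s => ?_
      rw [h₁, h₂, h]
  have : TP.toFunctor.IsAccessible.{w} := Fiber.isAccessible_monad P T hη
  obtain ⟨Z, h, hZ, hZ'⟩ := TP.exists_universal_coequalizing u v
  rw [key] at hZ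
  let Z₀ := Fiber.toAlgebra Z
  let f : Multimap (algObjects T) X Z₀ := {
    fn := Z.A.fn
    lin := fun j z => ⟨inn ⟨j, z⟩ ≫ h.map, hZ ⟨j, z⟩⟩
    map_lin := fun j z a => (congrArg h.map.obj (inn_obj ⟨j, z⟩ a)).trans (h.map_fn _) }
  let e := Equiv.ofBijective _ Z.A.bij
  have he (p) : e.symm (Z.A.fn p) = p := e.symm_apply_apply p
  have he' (x) : Z.A.fn (e.symm x) = x := e.apply_symm_apply x
  refine ⟨Z₀, f, fun c => ⟨fun h₁ h₂ h₁₂ => ?_, fun g => ?_⟩, Z.A.bij⟩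
  -- Both morphisms have the same object function because `Z.A.fn` is surjective. So both lift to
  -- the inverse image of `c` over `P`, where the uniqueness in the fibre applies.
  · let g (p : P) : c.A.Obj := h₁.f.obj (Z.A.fn p)
    have hg₁ (x) : h₁.f.obj x = g (e.symm x) := congrArg h₁.f.obj (he' x).symm
    have hg₂ (x) : h₂.f.obj x = g (e.symm x) := (congrArg h₂.f.obj (he' x).symm).trans
      (congrFun (congrArg Multimap.fn h₁₂) (e.symm x)).symm
    let Y : TP.Algebra :=
      Fiber.algebra (P := P) hη (pullbackAlgebra hη c g) id Function.bijective_id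
    let L₁ := pullbackAlgebraLift hη h₁ _ hg₁
    let L₂ := pullbackAlgebraLift hη h₂ _ hg₂
    let l₁ : Z ⟶ Y := ⟨⟨L₁.f, he⟩, Fiber.hom_ext L₁.h⟩
    let l₂ : Z ⟶ Y := ⟨⟨L₂.f, he⟩, Fiber.hom_ext L₂.h⟩
    have hk : h ≫ l₂.f = h ≫ l₁.f := by
      refine hW' _ _ _ fun s => ?_
      refine pullback_hom_ext (Y := c.A) (g := g) (fun _ => rfl) ?_
      let h₀ : W.graph ⟶ Z₀.A := h.map
      let M₁ : Z₀.A ⟶ pullback c.A g := L₁.f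
      let M₂ : Z₀.A ⟶ pullback c.A g := L₂.f
      have e₁ : M₁ ≫ pullbackMap c.A g = h₁.f := pullbackLift_map _ _ hg₁
      have e₂ : M₂ ≫ pullbackMap c.A g = h₂.f := pullbackLift_map _ _ hg₂
      have e₀ : (inn s ≫ h₀) ≫ h₂.f = (inn s ≫ h₀) ≫ h₁.f := congrArg Monad.Algebra.Hom.f
        (congrFun (congrFun (congrArg Multimap.lin h₁₂) s.1) s.2).symm
      have e₃ : (inn s ≫ h₀ ≫ M₂) ≫ pullbackMap c.A g = (inn s ≫ h₀ ≫ M₁) ≫ pullbackMap c.A g := by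
        rw [Category.assoc, Category.assoc, Category.assoc, Category.assoc, e₁, e₂,
          ← Category.assoc, e₀, Category.assoc]
      exact e₃
    have hl₁ : u ≫ TP.map (h ≫ l₁.f) ≫ Y.a = v ≫ TP.map (h ≫ l₁.f) ≫ Y.a := by
      refine (key Y _).2 fun s => ?_
      let h₀ : W.graph ⟶ Z₀.A := h.map
      have e₁ : (inn s ≫ h₀) ≫ L₁.f = inn s ≫ h₀ ≫ L₁.f := Category.assoc _ _ _
      have e₂ : T.map ((inn s ≫ h₀) ≫ L₁.f) ≫ (pullbackAlgebra hη c g).a =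
          (X s.1).a ≫ (inn s ≫ h₀) ≫ L₁.f := (f.lin s.1 s.2 ≫ L₁).h
      rw [e₁] at e₂
      exact e₂
    have hl : l₁ = l₂ := (hZ' Y _ hl₁).unique rfl hk
    have hL : L₁ = L₂ := by
      ext
      exact congrArg (fun l : Z ⟶ Y => l.f.map) hl
    rw [← pullbackAlgebraLift_map hη h₁ _ hg₁, ← pullbackAlgebraLift_map hη h₂ _ hg₂]
    exact congrArg (· ≫ _) hL
  -- The linear parts of `g` lift to the inverse image of `c` along `g.fn`, giving a map out of `W`
  -- in the fibre.
  · let Q := pullbackAlgebra hη c g.fn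
    let Y : TP.Algebra := Fiber.algebra (P := P) hη Q id Function.bijective_id
    let m (s : S) : X s.1 ⟶ Q := pullbackAlgebraLift hη (g.lin s.1 s.2) (i s) (g.map_lin s.1 s.2)
    obtain ⟨k, hk⟩ := hW Y.A (fun s => (m s).f) fun _ _ => rfl
    obtain ⟨l, hl, -⟩ := hZ' Y k ((key Y k).2 fun s => by
      rw [hk]
      exact (m s).h)
    let l₀ : Z₀ ⟶ Q := ⟨l.f.map, congrArg Fiber.Hom.map l.h⟩
    refine ⟨l₀ ≫ pullbackAlgebraMap hη c g.fn, Multimap.ext (funext fun p => ?_)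
      (funext fun j => funext fun z => ?_)⟩
    · exact congrArg g.fn (l.f.map_fn p)
    · have e₁ : f.lin j z ≫ l₀ = m ⟨j, z⟩ := by
        ext
        rw [← hk, ← hl]
        exact Category.assoc _ _ _
      refine (Category.assoc _ _ _).symm.trans ((congrArg (· ≫ _) e₁).trans ?_)
      exact pullbackAlgebraLift_map hη _ _ _

include hη in
-- Inverse image along the bijection `f.fn` replaces the object set of the target by the product
-- itself, up to isomorphism of algebras.
theorem exists_isUniversal_isIdentity [HasColimitsOfSize.{w, w} V] [T.toFunctor.IsAccessible.{w}]
    {ι : Type} [DecidableEq ι] (X : ι → T.Algebra) :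
    ∃ (Z : T.Algebra) (f : Multimap (algObjects T) X Z), f.IsUniversal ∧ IsIdentity f.fn := by
  obtain ⟨Z, f, hf, hb⟩ := exists_isUniversal_bijective hη X
  let e := Equiv.ofBijective _ hb
  have he (p) : e.symm (f.fn p) = p := e.symm_apply_apply p
  have h (x : Z.A.Obj) : (Monad.Algebra.Hom.f (𝟙 Z)).obj x = f.fn (e.symm x) :=
    (e.apply_symm_apply x).symm
  let Q := pullbackAlgebra hη Z f.fn
  let q : Q ⟶ Z := pullbackAlgebraMap hη Z f.fn
  let r : Z ⟶ Q := pullbackAlgebraLift hη (𝟙 Z) e.symm h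
  have hr : r ≫ q = 𝟙 Z := pullbackAlgebraLift_map hη _ _ _
  have hq : q ≫ r = 𝟙 Q := by
    ext
    refine pullback_hom_ext (Y := Z.A) (g := f.fn) he ?_
    have e₁ : (q ≫ r) ≫ q = 𝟙 _ ≫ q := by
      rw [Category.assoc, hr, Category.comp_id, Category.id_comp]
    exact congrArg Monad.Algebra.Hom.f e₁
  exact ⟨Q, f.postcomp r, hf.postcomp_iso ⟨r, q, hr, hq⟩, rfl, he⟩

end VGraph

theorem IsIdentity.bijective {α β : Type w} {f : α → β} (hf : IsIdentity f) :
    Function.Bijective f := by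
  obtain ⟨rfl, h⟩ := hf
  rw [show f = id from funext h]
  exact Function.bijective_id

/-- A function which becomes an identity after composition with identities is an identity. -/
theorem IsIdentity.of_comp {α β γ : Type w} {f : α → β} {g : γ → α} {k : β → γ}
    (hf : IsIdentity f) (hg : IsIdentity g) (h : ∀ x, g (k (f x)) = x) : IsIdentity k := by
  obtain ⟨rfl, hf⟩ := hf
  obtain ⟨rfl, hg⟩ := hg
  exact ⟨rfl, fun x => by simpa [hf, hg] using h x⟩

/-! ### Units -/

section

variable {A : Type u} [Category.{v} A] (U : A ⥤ Type w)

/-- The element `p` of `P` exhibits `P` as a representing object. -/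
def IsRepresentedBy (P : A) (p : U.obj P) : Prop :=
  ∀ (c : A) (y : U.obj c), ∃! h : P ⟶ c, U.map h p = y

/-- A representing object with exactly one element. -/
def IsFreePoint (P : A) : Prop :=
  ∃ p : U.obj P, IsRepresentedBy U P p ∧ ∀ x, x = p

variable {U}

theorem IsRepresentedBy.exists_iso {P Q : A} {p : U.obj P} {q : U.obj Q}
    (hp : IsRepresentedBy U P p) (hq : IsRepresentedBy U Q q) : ∃ e : P ≅ Q, U.map e.hom p = q := by
  obtain ⟨f, hf, -⟩ := hp Q q
  obtain ⟨g, hg, -⟩ := hq P p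
  exact ⟨⟨f, g, (hp P p).unique (by simp [hf, hg]) (by simp),
    (hq Q q).unique (by simp [hf, hg]) (by simp)⟩, hf⟩

theorem IsFreePoint.hom_ext {P c : A} (hP : IsFreePoint U P) {f g : P ⟶ c}
    (h : ∀ x, U.map f x = U.map g x) : f = g := by
  obtain ⟨p, hp, -⟩ := hP
  exact (hp c _).unique (h p) rfl

theorem IsFreePoint.exists_hom {P : A} (hP : IsFreePoint U P) {c : A} (y : U.obj c) :
    ∃ f : P ⟶ c, ∀ x, U.map f x = y := by
  obtain ⟨p, hp, hx⟩ := hP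
  obtain ⟨f, hf, -⟩ := hp c y
  exact ⟨f, fun x => by rw [hx x, hf]⟩

theorem IsFreePoint.subsingleton {P : A} (hP : IsFreePoint U P) : Subsingleton (U.obj P) := by
  obtain ⟨p, -, hx⟩ := hP
  exact ⟨fun x y => (hx x).trans (hx y).symm⟩

theorem IsFreePoint.of_iso {P Q : A} (hP : IsFreePoint U P) (e : P ≅ Q) : IsFreePoint U Q := by
  obtain ⟨p, hp, hx⟩ := hP
  refine ⟨U.map e.hom p, fun c y => ?_, fun x => ?_⟩
  · obtain ⟨h, hh, hu⟩ := hp c y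
    refine ⟨e.inv ≫ h, ?_, fun h' hh' => ?_⟩
    · dsimp only
      rw [← Functor.map_comp_apply, e.hom_inv_id_assoc, hh]
    rw [Iso.eq_inv_comp]
    exact hu _ (by simpa using hh')
  · rw [← hx (U.map e.inv x), ← Functor.map_comp_apply, e.inv_hom_id, Functor.map_id_apply]

namespace Multimap

variable {ι : Type} [DecidableEq ι] {X : ι → A} {b : A}

theorem fn_eq_map_lin (f : Multimap U X b) (j : ι) (x : ∀ k, U.obj (X k)) :
    f.fn x = U.map (f.lin j fun k => x k) (x j) := by
  refine Eq.trans (congrArg f.fn (funext fun k => ?_)) (f.map_lin j _ _).symm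
  by_cases hk : k = j
  · subst hk
    exact (insertAt_self (F := fun k => U.obj (X k)) k _ _).symm
  · exact (insertAt_ne (F := fun k => U.obj (X k)) j (fun k => x k) _ k hk).symm

/-- A linear part of a universal multimap all whose other inputs are free points is
invertible. -/
theorem IsUniversal.isIso_lin {f : Multimap U X b} (hf : f.IsUniversal) (j : ι)
    (hX : ∀ k ≠ j, IsFreePoint U (X k)) (z : ∀ k : {k // k ≠ j}, U.obj (X k)) :
    IsIso (f.lin j z) := by
  have hz (z' : ∀ k : {k // k ≠ j}, U.obj (X k)) : z' = z :=
    funext fun k => (hX k.1 k.2).subsingleton.elim _ _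
  refine isIso_of_coyoneda_map_bijective _ fun c => ⟨fun h h' e => ?_, fun h => ?_⟩
  · dsimp only at e
    have hfn (x) : U.map h (f.fn x) = U.map h' (f.fn x) := by
      rw [f.fn_eq_map_lin j x, hz fun k => x k, ← Functor.map_comp_apply, e,
        Functor.map_comp_apply]
    refine (hf c).1 (Multimap.ext (funext hfn) (funext fun k => funext fun y => ?_))
    by_cases hk : k = j
    · subst hk
      rw [hz y]
      exact e
    · refine (hX k hk).hom_ext fun x => ?_
      rw [(f.postcomp h).map_lin, (f.postcomp h').map_lin]
      exact hfn _
  -- To extend `h` along the linear part, use the multimap that depends only on the `j`-th variable.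
  -- Its linear parts in the other variables are constant maps, which exist out of free points.
  · choose pt hpt using fun (k : ι) (hk : k ≠ j) (y : U.obj c) => (hX k hk).exists_hom y
    let g : Multimap U X c := {
      fn := fun x => U.map h (x j)
      lin := fun k y =>
        if hk : k = j then eqToHom (congrArg X hk) ≫ h
        else pt k hk (U.map h (y ⟨j, Ne.symm hk⟩))
      map_lin := fun k y a => by
        by_cases hk : k = j
        · subst hk
          simp [insertAt_self]
        · simp only [hk, dite_false, hpt]
          rw [insertAt_ne _ _ _ _ (Ne.symm hk)] }
    obtain ⟨l, hl⟩ := (hf c).2 g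
    refine ⟨l, (congrFun (congrFun (congrArg Multimap.lin hl) j) z).trans ?_⟩
    simp [g]

end Multimap

namespace TensorChoice

variable (R : TensorChoice U)

/-- A nullary multimap into `c` is just an element of `c`. -/
theorem isRepresentedBy_unit : IsRepresentedBy U R.unit R.unitPt := by
  intro c y
  let g : Multimap U (fun i : Fin 0 => (i.elim0 : A)) c :=
    ⟨fun _ => y, fun i => i.elim0, fun i => i.elim0⟩
  have hR := (R.strong (n := 0) fun i => i.elim0).1 c
  obtain ⟨h, hh⟩ := hR.2 g
  refine ⟨h, congrFun (congrArg Multimap.fn hh) fun i => i.elim0, fun h' e => hR.1 ?_⟩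
  refine Eq.trans (Multimap.ext (funext fun x => ?_) (funext fun i => i.elim0)) hh.symm
  rw [show x = fun i => i.elim0 from funext fun i => i.elim0]
  exact e

theorem map_fn {n : ℕ} {X Y : Fin n → A} (g : ∀ i, X i ⟶ Y i) (x : ∀ i, U.obj (X i)) :
    U.map (R.map g) ((R.univ X).fn x) = (R.univ Y).fn fun i => U.map (g i) (x i) :=
  congrFun (congrArg Multimap.fn ((Equiv.ofBijective _
    ((R.strong X).1 (R.tensor Y))).apply_symm_apply ((R.univ Y).precomp g))) x

variable {R}

theorem isFreePoint_single (hI : IsFreePoint U R.unit) {n : ℕ} (X : Fin n → A) {j k : Fin n}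
    (hk : k ≠ j) : IsFreePoint U (R.single X j k) :=
  hI.of_iso (eqToIso (if_neg hk).symm)

theorem isIso_singleIncl (hI : IsFreePoint U R.unit) {n : ℕ} (X : Fin n → A) (j : Fin n) :
    IsIso (R.singleIncl X j) := by
  have := (R.strong (R.single X j)).1.isIso_lin j (fun _ => isFreePoint_single hI X)
    fun k => U.map (eqToHom (if_neg k.2).symm) R.unitPt
  exact @IsIso.comp_isIso _ _ _ _ _ _ _ inferInstance this

/-- Both sides are the value of the universal multimap at `x j` and the unit elements, since the
unit has only one element. -/
theorem map_map_singleProj (hI : IsFreePoint U R.unit) (hI' : IsTerminal R.unit) {n : ℕ}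
    (X : Fin n → A) (j : Fin n) (x : ∀ i, U.obj (X i)) :
    U.map (R.map (R.singleProj hI' X j)) ((R.univ X).fn x) = U.map (R.singleIncl X j) (x j) := by
  refine (R.map_fn _ _).trans (Eq.trans (congrArg _ (funext fun k => ?_))
    ((Functor.map_comp_apply _ _ _ _).trans (Multimap.map_lin _ _ _ _)).symm)
  by_cases hk : k = j
  · subst hk
    refine Eq.trans ?_ (insertAt_self (F := fun k' => U.obj (R.single X k k')) k _ _).symm
    exact congrArg (fun f => U.map f (x k)) (dif_pos rfl)
  · exact (isFreePoint_single hI X hk).subsingleton.elim _ _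

/-- The comparison map is an identity on elements if the universal multimap and the family of
projections are. -/
theorem exists_isComparison (hI : IsFreePoint U R.unit) (hI' : IsTerminal R.unit) {n : ℕ}
    {X : Fin n → A} {c : Fan X} (hc : IsLimit c) (hX : IsIdentity (R.univ X).fn)
    (hc' : IsIdentity fun (x : U.obj c.pt) (j : Fin n) => U.map (c.proj j) x) :
    ∃ κ : R.tensor X ⟶ c.pt, R.IsComparison hI' c κ ∧ IsIdentity (U.map κ) := by
  have (j : Fin n) := isIso_singleIncl hI X j
  let κ : R.tensor X ⟶ c.pt :=
    Fan.IsLimit.lift hc fun j => R.map (R.singleProj hI' X j) ≫ inv (R.singleIncl X j)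
  have hκ (j) : κ ≫ c.proj j = R.map (R.singleProj hI' X j) ≫ inv (R.singleIncl X j) :=
    Fan.IsLimit.fac hc _ j
  refine ⟨κ, fun j => ⟨asIso (R.singleIncl X j), rfl, hκ j⟩,
    hX.of_comp hc' fun x => funext fun j => ?_⟩
  rw [← Functor.map_comp_apply, hκ, Functor.map_comp_apply, map_map_singleProj hI,
    ← Functor.map_comp_apply, IsIso.hom_inv_id]
  simp

variable (R)

/-- If there are maps from tensor products to products, then the unit, having just one element,
is terminal. -/
theorem isTerminal_unit (hI : IsFreePoint U R.unit)
    (P : ∀ {n : ℕ} (X : Fin n → A), LimitCone (Discrete.functor X))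
    (h : ∀ B C : A, Nonempty (R.tensor ![B, C] ⟶ (P ![B, C]).cone.pt)) :
    Nonempty (IsTerminal R.unit) := by
  let L := P fun i : Fin 0 => (i.elim0 : A)
  let t : IsTerminal L.cone.pt := IsTerminal.ofUniqueHom
    (fun Y => Fan.IsLimit.lift L.isLimit fun i : Fin 0 => (i.elim0 : Y ⟶ _))
    fun _ _ => Fan.IsLimit.hom_ext L.isLimit _ _ fun i : Fin 0 => i.elim0
  -- Take the unit and the terminal object, the empty product. Fixing the first variable at the unit
  -- element gives the map from the terminal object into their tensor product with which `r` starts.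
  obtain ⟨m⟩ := h R.unit L.cone.pt
  let r : L.cone.pt ⟶ R.unit :=
    (R.univ ![R.unit, L.cone.pt]).lin 1 (fun k => match k with
      | ⟨0, _⟩ => R.unitPt
      | ⟨1, hk⟩ => absurd rfl hk) ≫ m ≫ Fan.proj (P ![R.unit, L.cone.pt]).cone 0
  exact ⟨t.ofIso ⟨r, t.from _, t.hom_ext _ _, hI.hom_ext fun _ => hI.subsingleton.elim _ _⟩⟩

end TensorChoice

end

namespace VGraph

variable {V : Type u} [Category.{v} V] (T : Monad (VGraph.{w} V))

/-- As the hom of `0` is initial, a graph map out of `0` is a choice of object. The free algebra has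
one object since the unit is bijective on objects. -/
theorem isFreePoint_free_zero [HasInitial V] (hη : ∀ X, Function.Bijective (T.η.app X).obj) :
    IsFreePoint (algObjects T) (T.free.obj (zero V)) := by
  refine ⟨(T.η.app (zero V)).obj PUnit.unit, fun c y => ?_, fun x => ?_⟩
  · let g : zero V ⟶ c.A := ⟨fun _ => y, fun _ _ => initial.to _⟩
    let e := T.adj.homEquiv (zero V) c
    have he (h) : e h = T.η.app (zero V) ≫ h.f := by
      refine (Adjunction.homEquiv_unit ..).trans ?_
      rw [Monad.adj_unit]
      rfl
    refine ⟨e.symm g, ?_, fun h hh => ?_⟩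
    · exact congr_obj ((he _).symm.trans (e.apply_symm_apply g)) PUnit.unit
    · refine e.eq_symm_apply.2 ((he h).trans ?_)
      exact hom_ext (fun _ => hh) fun _ _ => initial.hom_ext _ _
  · obtain ⟨⟨⟩, rfl⟩ := exists_unit_eq hη x
    rfl

end VGraph

namespace VGraph

variable {V : Type u} [Category.{v} V] (T : Monad (VGraph.{w} V))

/-- If the monad is well-pointed, then its free algebra on `0` is terminal. -/
theorem isTerminal_free_zero [HasInitial V] (hT : IsWellPointed T) :
    Nonempty (IsTerminal (T.free.obj (zero V))) := by
  obtain ⟨t⟩ := hT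
  refine ⟨IsTerminal.ofUniqueHom (fun c => ⟨t.from c.A, t.hom_ext _ _⟩) fun c m => ?_⟩
  ext
  exact t.hom_ext _ _

end VGraph

/-! ### The main theorem -/

theorem IsOverSet.bijective_unit {V : Type u} [Category.{v} V] {T : Monad (VGraph.{w} V)}
    (hT : IsOverSet T) (X : VGraph.{w} V) : Function.Bijective (T.η.app X).obj :=
  (hT.unit X).bijective

theorem hasColimits_of_isLocallyPresentable (V : Type u) [Category.{w} V]
    [IsLocallyPresentable.{w} V] : HasColimitsOfSize.{w, w} V := by
  obtain ⟨κ, _, _⟩ := IsLocallyPresentable.exists_cardinal.{w} V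
  infer_instance

theorem mainTheorem8 {V : Type u} [Category.{w} V] [IsLocallyPresentable.{w} V]
    (T : Monad (VGraph.{w} V)) (hT : IsOverSet T) (hacc : T.toFunctor.IsAccessible.{w}) :
    (∃ (R : TensorChoice (algObjects T))
        (P : ∀ {n : ℕ} (X : Fin n → T.Algebra), LimitCone (Discrete.functor X)),
      (∀ {n : ℕ} (X : Fin n → T.Algebra), IsIdentity (R.univ X).fn) ∧
      (∀ {n : ℕ} (X : Fin n → T.Algebra),
        IsIdentity fun (x : (algObjects T).obj (P X).cone.pt) (j : Fin n) =>
          (algObjects T).map (Fan.proj (P X).cone j) x) ∧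
      (IsWellPointed T →
        ∃ hI : IsTerminal R.unit, ∀ {n : ℕ} (X : Fin n → T.Algebra),
          ∃ κ : R.tensor X ⟶ (P X).cone.pt,
            R.IsComparison hI (P X).cone κ ∧ IsIdentity ((algObjects T).map κ))) ∧
    (∀ (R : TensorChoice (algObjects T))
        (P : ∀ {n : ℕ} (X : Fin n → T.Algebra), LimitCone (Discrete.functor X)),
      (∀ A B : T.Algebra, Nonempty (R.tensor ![A, B] ⟶ (P ![A, B]).cone.pt)) →
        Nonempty (R.unit ≅ T.free.obj (VGraph.zero V)) ∧
          Nonempty (IsTerminal (T.free.obj (VGraph.zero V)))) := by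
  have hη := hT.bijective_unit
  have hF : IsFreePoint (algObjects T) (T.free.obj (VGraph.zero V)) :=
    VGraph.isFreePoint_free_zero T hη
  have hu (R : TensorChoice (algObjects T)) : Nonempty (R.unit ≅ T.free.obj (VGraph.zero V)) := by
    obtain ⟨p, hp, -⟩ := hF
    obtain ⟨e, -⟩ := R.isRepresentedBy_unit.exists_iso hp
    exact ⟨e⟩
  have : HasColimitsOfSize.{w, w} V := hasColimits_of_isLocallyPresentable V
  have : HasLimitsOfSize.{w, w} V := hasLimits_of_isLocallyPresentable V
  have : HasLimitsOfSize.{0, 0} V := hasLimitsOfSizeShrink.{0, 0, w, w} V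
  refine ⟨?_, fun R P h => ?_⟩
  · choose Z f hf hf' using fun (n : ℕ) (X : Fin n → T.Algebra) =>
      VGraph.exists_isUniversal_isIdentity hη X
    let R : TensorChoice (algObjects T) := {
      tensor := fun {n} X => Z n X
      univ := fun {n} X => f n X
      strong := fun {n} X => (hf n X).isStronglyUniversal (hf' n X).bijective }
    -- Products are lifted from the explicit products of graphs, so that their object sets are the
    -- products of the object sets on the nose.
    let P {n : ℕ} (X : Fin n → T.Algebra) : LimitCone (Discrete.functor X) := {
      cone := Monad.ForgetCreatesLimits.liftedCone (Discrete.functor X) _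
        (VGraph.isLimitProductCone (Discrete.functor X ⋙ T.forget))
      isLimit := Monad.ForgetCreatesLimits.liftedConeIsLimit (Discrete.functor X) _
        (VGraph.isLimitProductCone (Discrete.functor X ⋙ T.forget)) }
    have hP {n : ℕ} (X : Fin n → T.Algebra) :
        IsIdentity fun (x : (algObjects T).obj (P X).cone.pt) (j : Fin n) =>
          (algObjects T).map (Fan.proj (P X).cone j) x := ⟨rfl, fun _ => rfl⟩
    refine ⟨R, P, fun {n} X => hf' n X, hP, fun hw => ?_⟩
    obtain ⟨e⟩ := hu R
    obtain ⟨t⟩ := VGraph.isTerminal_free_zero T hw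
    exact ⟨t.ofIso e.symm, fun {n} X =>
      R.exists_isComparison (hF.of_iso e.symm) _ (P X).isLimit (hf' n X) (hP X)⟩
  · obtain ⟨e⟩ := hu R
    obtain ⟨t⟩ := R.isTerminal_unit (hF.of_iso e.symm) P h
    exact ⟨⟨e⟩, ⟨t.ofIso e⟩⟩
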